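/- Let $d, k \geq 2$ be integers, and let $\mathcal T_{d,k}$ be the rooted tree in which the root has $k$ children and every other vertex has $d$ children. An almost automorphism of $\mathcal T_{d,k}$ is a triple $(A,B,\varphi)$, where $A$ and $B$ are finite subtrees of $\mathcal T_{d,k}$ containing the root and $\varphi\colon \mathcal T_{d,k}\setminus A \to \mathcal T_{d,k}\setminus B$ is an isomorphism of forests. Two almost automorphisms $(A,B,\varphi)$ and $(A',B',\varphi')$ are identified if there is a finite subtree $A''$ containing $A\cup A'$ such that $\varphi$ and $\varphi'$ coincide on $\mathcal T_{d,k}\setminus A''$. The Neretin group $\mathcal N_{d,k}$ is the group of the resulting equivalence classes, with the multiplication induced by composition (of representatives restricted to the complements of sufficiently large finite subtrees). It carries the unique group topology for which the natural inclusion $\mathrm{Aut}(\mathcal T_{d,k})\to\mathcal N_{d,k}$ of the profinite automorphism group of the rooted tree is continuous and open; it is thus a locally compact group. For a locally compact group $G$, the Chabauty space $\mathrm{Sub}(G)$ is the set of closed subgroups of $G$, with the topology generated by the sets $\{H : H\cap K=\varnothing\}$ with $K\subseteq G$ compact and $\{H : H\cap U\neq\varnothing\}$ with $U\subseteq G$ open.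 Then $G=\mathcal N_{d,k}$ is an isolated point of $\mathrm{Sub}(G)$, i.e. $\{\mathcal N_{d,k}\}$ is an open subset of $\mathrm{Sub}(\mathcal N_{d,k})$. -/

import Mathlib

open Set

/-! ## The quasi-regular rooted tree -/

/-- Vertices of the rooted tree in which the root has `k` children and every other vertex has `d`
children: `none` is the root, and `some (i, [jₙ, …, j₁])` is reached from the root by first moving
to the child number `i`, and then successively to the children number `j₁`, …, `jₙ`. -/
abbrev TreeVertex (d k : ℕ) : Type := Option (Fin k × List (Fin d))

namespace TreeVertex

/-- The root. -/
def root (d k : ℕ) : TreeVertex d k := none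

/-- The parent of a vertex (with the convention that the parent of the root is the root). -/
def parent {d k : ℕ} : TreeVertex d k → TreeVertex d k
  | none => none
  | some (_, []) => none
  | some (i, _ :: w) => some (i, w)

/-- The distance to the root. -/
def depth {d k : ℕ} : TreeVertex d k → ℕ
  | none => 0
  | some (_, w) => w.length + 1

theorem depth_parent {d k : ℕ} {v : TreeVertex d k} (hv : v ≠ root d k) :
    depth (parent v) + 1 = depth v := by
  rcases v with _ | ⟨i, _ | ⟨j, w⟩⟩
  · exact absurd rfl hv
  · rfl
  · rfl

theorem parent_ne_self {d k : ℕ} {v : TreeVertex d k} (hv : v ≠ root d k) : parent v ≠ v := by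
  intro h
  have := depth_parent hv
  rw [h] at this
  omega

/-- The set of children of a vertex. -/
def children {d k : ℕ} (v : TreeVertex d k) : Set (TreeVertex d k) :=
  {w | w ≠ root d k ∧ parent w = v}

theorem children_some {d k : ℕ} (i : Fin k) (w : List (Fin d)) :
    children (some (i, w) : TreeVertex d k) = range fun j : Fin d => some (i, j :: w) := by
  ext u
  rcases u with _ | ⟨i', _ | ⟨j, w'⟩⟩
  · simp [children, root, parent]
  · simp [children, root, parent]
  · simp only [children, root, parent, mem_ofPred_eq, mem_range, Option.some.injEq,
      Prod.mk.injEq, List.cons.injEq]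
    constructor
    · rintro ⟨-, rfl, rfl⟩
      exact ⟨j, rfl, rfl, rfl⟩
    · rintro ⟨j', rfl, rfl, rfl⟩
      exact ⟨by simp, rfl, rfl⟩

theorem finite_children {d k : ℕ} (v : TreeVertex d k) : (children v).Finite := by
  rcases v with _ | ⟨i, w⟩
  · refine (finite_range fun i : Fin k => (some (i, []) : TreeVertex d k)).subset ?_
    rintro (_ | ⟨i', _ | ⟨j, w'⟩⟩) ⟨h1, h2⟩
    · exact absurd rfl h1
    · exact ⟨i', rfl⟩
    · simp [parent] at h2
  · rw [children_some]
    exact finite_range _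

theorem ncard_children {d k : ℕ} {v : TreeVertex d k} (hv : v ≠ root d k) :
    (children v).ncard = d := by
  rcases v with _ | ⟨i, w⟩
  · exact absurd rfl hv
  · rw [children_some, ← image_univ, ncard_image_of_injective, ncard_univ, Nat.card_fin]
    intro a b h
    simpa using h

end TreeVertex

open TreeVertex

/-- The rooted tree in which the root has `k` children and every other vertex has `d` children. -/
def quasiRegularTree (d k : ℕ) : SimpleGraph (TreeVertex d k) where
  Adj v w := w ∈ children v ∨ v ∈ children w
  symm := ⟨fun _ _ h => h.symm⟩
  loopless := ⟨fun _ h => h.elim (fun h => parent_ne_self h.1 h.2) fun h => parent_ne_self h.1 h.2⟩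

/-- `A` is the vertex set of a finite subtree containing the root. -/
structure IsFiniteRootedSubtree {d k : ℕ} (A : Set (TreeVertex d k)) : Prop where
  finite : A.Finite
  root_mem : root d k ∈ A
  connected : ((quasiRegularTree d k).induce A).Connected

namespace IsFiniteRootedSubtree

variable {d k : ℕ} {A : Set (TreeVertex d k)}

theorem parent_mem (hA : IsFiniteRootedSubtree A) {v : TreeVertex d k} (hv : v ∈ A) :
    parent v ∈ A := by
  classical
  by_cases hr : v = root d k
  · subst hr; exact hv
  -- the set of descendants of `v`
  let S : Set (TreeVertex d k) := {w | ∃ n, parent^[n] w = v}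
  have hroot : ∀ n, parent^[n] (root d k) = root d k := fun n => by
    induction n with
    | zero => rfl
    | succ n ih => rw [Function.iterate_succ_apply']; rw [ih]; rfl
  obtain ⟨p⟩ := hA.connected.preconnected ⟨v, hv⟩ ⟨root d k, hA.root_mem⟩
  obtain ⟨e, -, h1, h2⟩ := p.exists_boundary_dart {w | (w : TreeVertex d k) ∈ S} ⟨0, rfl⟩
    (fun ⟨n, hn⟩ => hr (by rw [← hn]; exact (hroot n)))
  have hadj : (quasiRegularTree d k).Adj e.fst e.snd := e.adj
  obtain ⟨n, hn⟩ := h1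
  rcases hadj with h | h
  · exact absurd ⟨n + 1, by rw [Function.iterate_succ_apply, h.2, hn]⟩ h2
  · cases n with
    | zero =>
      have hn' : (e.fst : TreeVertex d k) = v := hn
      rw [← hn', h.2]
      exact e.snd.2
    | succ n => exact absurd ⟨n, by rw [← h.2, ← Function.iterate_succ_apply, hn]⟩ h2

theorem of_parent_mem (hf : A.Finite) (hr : root d k ∈ A) (hp : ∀ v ∈ A, parent v ∈ A) :
    IsFiniteRootedSubtree A := by
  refine ⟨hf, hr, ?_⟩
  have key : ∀ n, ∀ v (hv : v ∈ A), depth v = n →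
      ((quasiRegularTree d k).induce A).Reachable ⟨v, hv⟩ ⟨root d k, hr⟩ := by
    intro n
    induction n with
    | zero =>
      intro v hv hn
      rcases v with _ | ⟨i, w⟩
      · exact SimpleGraph.Reachable.refl _
      · simp [depth] at hn
    | succ n ih =>
      intro v hv hn
      have hv0 : v ≠ root d k := by
        rintro rfl
        simp [depth, root] at hn
      have hd := depth_parent hv0
      refine SimpleGraph.Reachable.trans ?_ (ih (parent v) (hp v hv) (by omega))
      exact SimpleGraph.Adj.reachable
        (show (quasiRegularTree d k).Adj v (parent v) from Or.inr ⟨hv0, rfl⟩)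
  have : Nonempty A := ⟨⟨root d k, hr⟩⟩
  exact ⟨fun a b => (key _ a a.2 rfl).trans (key _ b b.2 rfl).symm⟩

theorem singleton_root : IsFiniteRootedSubtree {root d k} :=
  of_parent_mem (finite_singleton _) rfl (by rintro _ rfl; rfl)

theorem union {B : Set (TreeVertex d k)} (hA : IsFiniteRootedSubtree A)
    (hB : IsFiniteRootedSubtree B) : IsFiniteRootedSubtree (A ∪ B) :=
  of_parent_mem (hA.finite.union hB.finite) (Or.inl hA.root_mem)
    fun _ hv => hv.imp hA.parent_mem hB.parent_mem

/-- Every finite set of vertices lies in a finite subtree containing the root. -/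
theorem exists_superset {F : Set (TreeVertex d k)} (hF : F.Finite) :
    ∃ A, IsFiniteRootedSubtree A ∧ F ⊆ A := by
  induction F, hF using Set.Finite.induction_on with
  | empty => exact ⟨_, singleton_root, empty_subset _⟩
  | @insert a s _ _ ih =>
    obtain ⟨A, hA, hs⟩ := ih
    have key : ∀ n, ∀ v : TreeVertex d k, depth v = n → ∃ B, IsFiniteRootedSubtree B ∧ v ∈ B := by
      intro n
      induction n with
      | zero =>
        intro v hn
        rcases v with _ | ⟨i, w⟩
        · exact ⟨_, singleton_root, rfl⟩
        · simp [depth] at hn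
      | succ n ih =>
        intro v hn
        have hv0 : v ≠ root d k := by
          rintro rfl
          simp [depth, root] at hn
        have hd := depth_parent hv0
        obtain ⟨B, hB, hv⟩ := ih (parent v) (by omega)
        refine ⟨insert v B, of_parent_mem (hB.finite.insert v) (Or.inr hB.root_mem) ?_,
          Or.inl rfl⟩
        rintro w (rfl | hw)
        · exact Or.inr hv
        · exact Or.inr (hB.parent_mem hw)
    obtain ⟨B, hB, ha⟩ := key _ a rfl
    refine ⟨A ∪ B, hA.union hB, ?_⟩
    rintro w (rfl | hw)
    · exact Or.inr ha
    · exact Or.inl (hs hw)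

end IsFiniteRootedSubtree

/-! ## Almost automorphisms -/

/-- An almost automorphism of the tree `T`: a triple `(A, B, φ)` of finite subtrees `A`, `B`
containing the root and an isomorphism of forests `φ : T ∖ A → T ∖ B`. It is encoded by the partial
bijection `φ` of the vertex set, so that `A` and `B` are the complements of its source and of its
target. (The existence of `φ` forces the boundaries of `A` and `B` to have the same cardinality,
namely the number of connected components of `T ∖ A` and of `T ∖ B`.) -/
structure AlmostAut (d k : ℕ) where
  toPartialEquiv : PartialEquiv (TreeVertex d k) (TreeVertex d k)
  source_subtree : IsFiniteRootedSubtree toPartialEquiv.sourceᶜ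
  target_subtree : IsFiniteRootedSubtree toPartialEquiv.targetᶜ
  adj_iff : ∀ v ∈ toPartialEquiv.source, ∀ w ∈ toPartialEquiv.source,
    (quasiRegularTree d k).Adj (toPartialEquiv v) (toPartialEquiv w) ↔
      (quasiRegularTree d k).Adj v w

namespace AlmostAut

variable {d k : ℕ}

/-- The inverse `(B, A, φ⁻¹)` of `(A, B, φ)`. -/
def symm (f : AlmostAut d k) : AlmostAut d k where
  toPartialEquiv := f.toPartialEquiv.symm
  source_subtree := f.target_subtree
  target_subtree := f.source_subtree
  adj_iff v hv w hw := by
    have hv' := f.toPartialEquiv.map_target hv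
    have hw' := f.toPartialEquiv.map_target hw
    have := f.adj_iff _ hv' _ hw'
    rw [f.toPartialEquiv.right_inv hv, f.toPartialEquiv.right_inv hw] at this
    exact this.symm

theorem ne_root_of_mem (f : AlmostAut d k) {v} (hv : v ∈ f.toPartialEquiv.source) :
    v ≠ root d k := by
  rintro rfl
  exact f.source_subtree.root_mem hv

theorem mem_of_parent_mem (f : AlmostAut d k) {v} (hv : parent v ∈ f.toPartialEquiv.source) :
    v ∈ f.toPartialEquiv.source := by
  by_contra h
  exact f.source_subtree.parent_mem h hv

/-- The neighbours in the source of `f` of a vertex. -/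
def nbrs (f : AlmostAut d k) (v : TreeVertex d k) : Set (TreeVertex d k) :=
  {w | w ∈ f.toPartialEquiv.source ∧ (quasiRegularTree d k).Adj v w}

theorem ncard_nbrs_of_mem (f : AlmostAut d k) {v} (hv : parent v ∈ f.toPartialEquiv.source) :
    (f.nbrs v).ncard = d + 1 := by
  have hvs := f.mem_of_parent_mem hv
  have : f.nbrs v = insert (parent v) (children v) := by
    ext w
    constructor
    · rintro ⟨hw, h | h⟩
      · exact Or.inr h
      · exact Or.inl h.2.symm
    · rintro (rfl | h)
      · exact ⟨hv, Or.inr ⟨f.ne_root_of_mem hvs, rfl⟩⟩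
      · exact ⟨f.mem_of_parent_mem (by rw [h.2]; exact hvs), Or.inl h⟩
  rw [this, ncard_insert_of_notMem _ (finite_children v), ncard_children (f.ne_root_of_mem hvs)]
  rintro ⟨h1, h2⟩
  have e1 := depth_parent h1
  have e2 := depth_parent (f.ne_root_of_mem hvs)
  rw [h2] at e1
  omega

theorem ncard_nbrs_of_notMem (f : AlmostAut d k) {v} (hvs : v ∈ f.toPartialEquiv.source)
    (hv : parent v ∉ f.toPartialEquiv.source) : (f.nbrs v).ncard = d := by
  have : f.nbrs v = children v := by
    ext w
    constructor
    · rintro ⟨hw, h | h⟩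
      · exact h
      · exact absurd (h.2 ▸ hw) hv
    · intro h
      exact ⟨f.mem_of_parent_mem (by rw [h.2]; exact hvs), Or.inl h⟩
  rw [this, ncard_children (f.ne_root_of_mem hvs)]

theorem ncard_nbrs_symm (f : AlmostAut d k) {v} (hv : v ∈ f.toPartialEquiv.source) :
    (f.symm.nbrs (f.toPartialEquiv v)).ncard = (f.nbrs v).ncard := by
  have : f.symm.nbrs (f.toPartialEquiv v) = f.toPartialEquiv '' f.nbrs v := by
    ext w
    constructor
    · rintro ⟨hw, h⟩
      have hw' := f.toPartialEquiv.map_target hw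
      refine ⟨f.toPartialEquiv.symm w, ⟨hw', ?_⟩, f.toPartialEquiv.right_inv hw⟩
      rw [← f.adj_iff _ hv _ hw', f.toPartialEquiv.right_inv hw]
      exact h
    · rintro ⟨u, ⟨hu, h⟩, rfl⟩
      exact ⟨f.toPartialEquiv.map_source hu, (f.adj_iff _ hv _ hu).2 h⟩
  rw [this]
  exact (f.toPartialEquiv.injOn.mono fun _ h => h.1).ncard_image

theorem parent_mem_target_iff (f : AlmostAut d k) {v} (hv : v ∈ f.toPartialEquiv.source) :
    parent (f.toPartialEquiv v) ∈ f.toPartialEquiv.target ↔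
      parent v ∈ f.toPartialEquiv.source := by
  have h := f.ncard_nbrs_symm hv
  by_cases h1 : parent v ∈ f.toPartialEquiv.source
  · rw [f.ncard_nbrs_of_mem h1] at h
    simp only [h1, iff_true]
    by_contra h2
    rw [f.symm.ncard_nbrs_of_notMem (f.toPartialEquiv.map_source hv) h2] at h
    omega
  · rw [f.ncard_nbrs_of_notMem hv h1] at h
    simp only [h1, iff_false]
    intro h2
    rw [f.symm.ncard_nbrs_of_mem h2] at h
    omega

/-- A forest isomorphism `T ∖ A → T ∖ B` is compatible with the parent maps. -/
theorem parent_apply (f : AlmostAut d k) {v} (hv : parent v ∈ f.toPartialEquiv.source) :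
    parent (f.toPartialEquiv v) = f.toPartialEquiv (parent v) := by
  have key : ∀ n, ∀ v : TreeVertex d k, depth v = n → parent v ∈ f.toPartialEquiv.source →
      parent (f.toPartialEquiv v) = f.toPartialEquiv (parent v) := by
    intro n
    induction n with
    | zero =>
      intro v hn hv
      rcases v with _ | ⟨i, w⟩
      · exact absurd rfl (f.ne_root_of_mem hv)
      · simp [depth] at hn
    | succ n ih =>
      intro v hn hv
      have hvs := f.mem_of_parent_mem hv
      have hv0 := f.ne_root_of_mem hvs
      have hadj : (quasiRegularTree d k).Adj v (parent v) := Or.inr ⟨hv0, rfl⟩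
      rcases (f.adj_iff _ hvs _ hv).2 hadj with h | h
      · exfalso
        have hpt : parent (parent v) ∈ f.toPartialEquiv.source := by
          rw [← f.parent_mem_target_iff hv, h.2]
          exact f.toPartialEquiv.map_source hvs
        have hd := depth_parent hv0
        have := ih (parent v) (by omega) hpt
        rw [h.2] at this
        have h3 := f.toPartialEquiv.injOn hvs hpt this
        have hd' := depth_parent (f.ne_root_of_mem hv)
        rw [← h3] at hd'
        omega
      · exact h.2
  exact key _ v rfl hv

theorem trans_source_subtree (f g : AlmostAut d k) :
    IsFiniteRootedSubtree (f.toPartialEquiv.trans g.toPartialEquiv).sourceᶜ := by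
  refine IsFiniteRootedSubtree.of_parent_mem ?_ ?_ ?_
  · refine (f.source_subtree.finite.union
      (g.source_subtree.finite.image f.toPartialEquiv.symm)).subset ?_
    intro v hv
    rw [PartialEquiv.trans_source] at hv
    by_cases h : v ∈ f.toPartialEquiv.source
    · exact Or.inr ⟨_, fun hg => hv ⟨h, hg⟩, f.toPartialEquiv.left_inv h⟩
    · exact Or.inl h
  · rw [PartialEquiv.trans_source]
    exact fun h => f.source_subtree.root_mem h.1
  · intro v hv hpv
    rw [PartialEquiv.trans_source] at hv hpv
    refine hv ⟨f.mem_of_parent_mem hpv.1, g.mem_of_parent_mem ?_⟩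
    rw [f.parent_apply hpv.1]
    exact hpv.2

/-- The composition "first `f`, then `g`", defined outside a sufficiently large finite subtree. -/
def trans (f g : AlmostAut d k) : AlmostAut d k where
  toPartialEquiv := f.toPartialEquiv.trans g.toPartialEquiv
  source_subtree := f.trans_source_subtree g
  target_subtree := g.symm.trans_source_subtree f.symm
  adj_iff v hv w hw := by
    rw [PartialEquiv.trans_source] at hv hw
    exact (g.adj_iff _ hv.2 _ hw.2).trans (f.adj_iff _ hv.1 _ hw.1)

/-- Automorphisms of the rooted tree: the automorphisms of the tree that fix the root. -/
def _root_.RootedTreeAut (d k : ℕ) : Subgroup (quasiRegularTree d k ≃g quasiRegularTree d k) where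
  carrier := {a | a (root d k) = root d k}
  mul_mem' {a b} ha hb := by
    simp only [mem_ofPred_eq] at ha hb ⊢
    rw [RelIso.mul_apply, hb, ha]
  one_mem' := rfl
  inv_mem' {a} ha := by
    simp only [mem_ofPred_eq] at ha ⊢
    rw [← ha, RelIso.inv_apply_self, ha]

/-- The almost automorphism `({root}, {root}, a)` given by an automorphism `a`. -/
def ofAut (a : RootedTreeAut d k) : AlmostAut d k where
  toPartialEquiv := (a.1 : quasiRegularTree d k ≃g quasiRegularTree d k).toEquiv.toPartialEquivOfImageEq
    {root d k}ᶜ {root d k}ᶜ (by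
      rw [image_compl_eq (a.1 : quasiRegularTree d k ≃g quasiRegularTree d k).toEquiv.bijective,
        image_singleton]
      exact congrArg (fun x => ({x} : Set (TreeVertex d k))ᶜ) a.2)
  source_subtree := by
    change IsFiniteRootedSubtree ({root d k}ᶜᶜ : Set (TreeVertex d k))
    rw [compl_compl]
    exact IsFiniteRootedSubtree.singleton_root
  target_subtree := by
    change IsFiniteRootedSubtree ({root d k}ᶜᶜ : Set (TreeVertex d k))
    rw [compl_compl]
    exact IsFiniteRootedSubtree.singleton_root
  adj_iff v _ w _ := (a.1 : quasiRegularTree d k ≃g quasiRegularTree d k).map_rel_iff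

/-- Two almost automorphisms `(A, B, φ)` and `(A', B', φ')` are identified if `φ` and `φ'` coincide
on the complement of some finite subtree that contains `A ∪ A'`. -/
def Equivalent (f g : AlmostAut d k) : Prop :=
  ∃ C : Set (TreeVertex d k), IsFiniteRootedSubtree C ∧
    f.toPartialEquiv.sourceᶜ ∪ g.toPartialEquiv.sourceᶜ ⊆ C ∧
      ∀ v ∉ C, f.toPartialEquiv v = g.toPartialEquiv v

theorem equivalent_of_finite {f g : AlmostAut d k} {F : Set (TreeVertex d k)} (hF : F.Finite)
    (h : ∀ v ∉ F, f.toPartialEquiv v = g.toPartialEquiv v) : f.Equivalent g := by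
  obtain ⟨C, hC, hFC⟩ := IsFiniteRootedSubtree.exists_superset hF
  exact ⟨C ∪ (f.toPartialEquiv.sourceᶜ ∪ g.toPartialEquiv.sourceᶜ),
    hC.union (f.source_subtree.union g.source_subtree), subset_union_right,
    fun v hv => h v fun hvF => hv (Or.inl (hFC hvF))⟩

/-- The equivalence relation `AlmostAut.Equivalent`. -/
instance setoid (d k : ℕ) : Setoid (AlmostAut d k) where
  r := Equivalent
  iseqv :=
    { refl := fun _ => equivalent_of_finite finite_empty fun _ _ => rfl
      symm := by
        rintro f g ⟨C, hC, -, h⟩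
        exact equivalent_of_finite hC.finite fun v hv => (h v hv).symm
      trans := by
        rintro f g l ⟨C, hC, -, h⟩ ⟨C', hC', -, h'⟩
        refine equivalent_of_finite (hC.finite.union hC'.finite) fun v hv => ?_
        rw [h v fun hv' => hv (Or.inl hv'), h' v fun hv' => hv (Or.inr hv')] }

theorem trans_congr {f f' g g' : AlmostAut d k} (hf : f.Equivalent f') (hg : g.Equivalent g') :
    (f.trans g).Equivalent (f'.trans g') := by
  obtain ⟨C, hC, hCs, h⟩ := hf
  obtain ⟨C', hC', -, h'⟩ := hg
  refine equivalent_of_finite (hC.finite.union (hC'.finite.image f.toPartialEquiv.symm))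
    fun v hv => ?_
  have hvC : v ∉ C := fun hv' => hv (Or.inl hv')
  have hvs : v ∈ f.toPartialEquiv.source := by
    by_contra hvs
    exact hvC (hCs (Or.inl hvs))
  change g.toPartialEquiv (f.toPartialEquiv v) = g'.toPartialEquiv (f'.toPartialEquiv v)
  rw [← h v hvC]
  exact h' _ fun hv' => hv (Or.inr ⟨_, hv', f.toPartialEquiv.left_inv hvs⟩)

theorem symm_congr {f f' : AlmostAut d k} (hf : f.Equivalent f') :
    f.symm.Equivalent f'.symm := by
  obtain ⟨C, hC, hCs, h⟩ := hf
  refine equivalent_of_finite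
    (f.target_subtree.finite.union (hC.finite.image f.toPartialEquiv)) fun w hw => ?_
  have hwt : w ∈ f.toPartialEquiv.target := by
    by_contra hwt
    exact hw (Or.inl hwt)
  have hvC : f.toPartialEquiv.symm w ∉ C :=
    fun hv => hw (Or.inr ⟨_, hv, f.toPartialEquiv.right_inv hwt⟩)
  have hv' : f.toPartialEquiv.symm w ∈ f'.toPartialEquiv.source := by
    by_contra hv'
    exact hvC (hCs (Or.inr hv'))
  change f.toPartialEquiv.symm w = f'.toPartialEquiv.symm w
  have := f'.toPartialEquiv.left_inv hv'
  rw [← h _ hvC, f.toPartialEquiv.right_inv hwt] at this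
  exact this.symm

end AlmostAut

/-! ## The Neretin group -/

/-- The Neretin group `𝒩_{d,k}`: the group of equivalence classes of almost automorphisms. -/
def NeretinGroup (d k : ℕ) : Type := Quotient (AlmostAut.setoid d k)

namespace NeretinGroup

variable {d k : ℕ}

/-- The class of an almost automorphism. -/
def mk (f : AlmostAut d k) : NeretinGroup d k := Quotient.mk _ f

theorem mk_eq_mk_of_finite {f g : AlmostAut d k} {F : Set (TreeVertex d k)} (hF : F.Finite)
    (h : ∀ v ∉ F, f.toPartialEquiv v = g.toPartialEquiv v) : mk f = mk g :=
  Quotient.sound (AlmostAut.equivalent_of_finite hF h)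

/-- Multiplication is composition of maps: the right-hand factor is applied first. -/
instance : Mul (NeretinGroup d k) :=
  ⟨Quotient.map₂ (fun f g => g.trans f) fun _ _ hf _ _ hg => AlmostAut.trans_congr hg hf⟩

instance : Inv (NeretinGroup d k) :=
  ⟨Quotient.map AlmostAut.symm fun _ _ hf => AlmostAut.symm_congr hf⟩

instance : One (NeretinGroup d k) := ⟨mk (AlmostAut.ofAut 1)⟩

instance : Group (NeretinGroup d k) :=
  Group.ofLeftAxioms
    (by
      rintro ⟨f⟩ ⟨g⟩ ⟨l⟩
      exact mk_eq_mk_of_finite finite_empty fun _ _ => rfl)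
    (by
      rintro ⟨f⟩
      exact mk_eq_mk_of_finite finite_empty fun _ _ => rfl)
    (by
      rintro ⟨f⟩
      refine mk_eq_mk_of_finite f.source_subtree.finite fun v hv => ?_
      exact f.toPartialEquiv.left_inv (not_not.1 hv))

/-- The natural map from the automorphism group of the rooted tree to the Neretin group. -/
def ofAut (d k : ℕ) : RootedTreeAut d k →* NeretinGroup d k where
  toFun a := mk (AlmostAut.ofAut a)
  map_one' := rfl
  map_mul' _ _ := mk_eq_mk_of_finite finite_empty fun _ _ => rfl

/-- The topology of the Neretin group: a basis of neighbourhoods of `g` is given by the cosets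
`g • Fix(F)`, where `F` ranges over the finite sets of vertices and `Fix(F)` is the group of the
automorphisms of the rooted tree that fix every vertex in `F`. This is the group topology for which
the natural map from the automorphism group of the rooted tree (with the topology of pointwise
convergence) is continuous and open. -/
instance : TopologicalSpace (NeretinGroup d k) where
  IsOpen U := ∀ g ∈ U, ∃ F : Set (TreeVertex d k), F.Finite ∧
    ∀ a : RootedTreeAut d k, (∀ v ∈ F, a.1 v = v) → g * ofAut d k a ∈ U
  isOpen_univ _ _ := ⟨∅, finite_empty, fun _ _ => mem_univ _⟩
  isOpen_inter U V hU hV g hg := by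
    obtain ⟨F, hF, h⟩ := hU g hg.1
    obtain ⟨F', hF', h'⟩ := hV g hg.2
    exact ⟨F ∪ F', hF.union hF', fun a ha =>
      ⟨h a fun v hv => ha v (Or.inl hv), h' a fun v hv => ha v (Or.inr hv)⟩⟩
  isOpen_sUnion S hS g := by
    rintro ⟨U, hU, hg⟩
    obtain ⟨F, hF, h⟩ := hS U hU g hg
    exact ⟨F, hF, fun a ha => ⟨U, hU, h a ha⟩⟩

/-- The conjugate `f a f⁻¹` of an automorphism `a`, extended by the identity. -/
noncomputable def conjFun (f : AlmostAut d k) (a : RootedTreeAut d k) (w : TreeVertex d k) :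
    TreeVertex d k :=
  open Classical in
  if w ∈ f.toPartialEquiv.target then f.toPartialEquiv (a.1 (f.toPartialEquiv.symm w)) else w

theorem conjFun_apply_of_mem (f : AlmostAut d k) (a : RootedTreeAut d k) {w : TreeVertex d k}
    (hw : w ∈ f.toPartialEquiv.target) :
    conjFun f a w = f.toPartialEquiv (a.1 (f.toPartialEquiv.symm w)) := if_pos hw

theorem conjFun_apply_of_notMem (f : AlmostAut d k) (a : RootedTreeAut d k) {w : TreeVertex d k}
    (hw : w ∉ f.toPartialEquiv.target) : conjFun f a w = w := if_neg hw

theorem map_mem_source (f : AlmostAut d k) (a : RootedTreeAut d k)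
    (ha : ∀ v ∈ f.toPartialEquiv.sourceᶜ, a.1 v = v) {v} (hv : v ∈ f.toPartialEquiv.source) :
    a.1 v ∈ f.toPartialEquiv.source := by
  by_contra h
  exact h ((a.1.injective (ha _ h)).symm ▸ hv)

theorem inv_fix (a : RootedTreeAut d k) {v : TreeVertex d k} (h : a.1 v = v) :
    (a⁻¹).1 v = v := by
  change (a.1⁻¹ : quasiRegularTree d k ≃g quasiRegularTree d k) v = v
  conv_lhs => rw [← h]
  exact RelIso.inv_apply_self _ _

theorem conjFun_inv (f : AlmostAut d k) (a : RootedTreeAut d k)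
    (ha : ∀ v ∈ f.toPartialEquiv.sourceᶜ, a.1 v = v) (w : TreeVertex d k) :
    conjFun f a⁻¹ (conjFun f a w) = w := by
  by_cases hw : w ∈ f.toPartialEquiv.target
  · have h1 := map_mem_source f a ha (f.toPartialEquiv.map_target hw)
    rw [conjFun_apply_of_mem f a hw, conjFun_apply_of_mem f _ (f.toPartialEquiv.map_source h1),
      f.toPartialEquiv.left_inv h1]
    have : (a⁻¹).1 (a.1 (f.toPartialEquiv.symm w)) = f.toPartialEquiv.symm w :=
      RelIso.inv_apply_self _ _
    rw [this, f.toPartialEquiv.right_inv hw]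
  · rw [conjFun_apply_of_notMem f a hw, conjFun_apply_of_notMem f _ hw]

/-- The finite set `A ∪ f⁻¹(F ∪ children of B)`. -/
def conjSet (f : AlmostAut d k) (F : Set (TreeVertex d k)) : Set (TreeVertex d k) :=
  f.toPartialEquiv.sourceᶜ ∪
    f.toPartialEquiv.symm '' (F ∪ ⋃ v ∈ f.toPartialEquiv.targetᶜ, children v)

theorem finite_conjSet (f : AlmostAut d k) {F : Set (TreeVertex d k)} (hF : F.Finite) :
    (conjSet f F).Finite :=
  f.source_subtree.finite.union
    ((hF.union (f.target_subtree.finite.biUnion fun v _ => finite_children v)).image _)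

theorem conjFun_fix (f : AlmostAut d k) {F : Set (TreeVertex d k)} (a : RootedTreeAut d k)
    (ha : ∀ v ∈ conjSet f F, a.1 v = v) {w : TreeVertex d k}
    (hw : w ∈ F ∪ ⋃ v ∈ f.toPartialEquiv.targetᶜ, children v) : conjFun f a w = w := by
  by_cases h : w ∈ f.toPartialEquiv.target
  · rw [conjFun_apply_of_mem f a h, ha _ (Or.inr ⟨w, hw, rfl⟩), f.toPartialEquiv.right_inv h]
  · exact conjFun_apply_of_notMem f a h

theorem conjFun_adj_aux (f : AlmostAut d k) {F : Set (TreeVertex d k)} (a : RootedTreeAut d k)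
    (ha : ∀ v ∈ conjSet f F, a.1 v = v) {v w : TreeVertex d k}
    (hv : v ∉ f.toPartialEquiv.target) (h : (quasiRegularTree d k).Adj v w) :
    conjFun f a w = w := by
  rcases h with h | h
  · exact conjFun_fix f a ha (Or.inr (mem_biUnion hv h))
  · exact conjFun_apply_of_notMem f a (by
      have := f.target_subtree.parent_mem hv
      rw [h.2] at this
      exact this)

theorem conjFun_adj (f : AlmostAut d k) {F : Set (TreeVertex d k)} (a : RootedTreeAut d k)
    (ha : ∀ v ∈ conjSet f F, a.1 v = v) {v w : TreeVertex d k}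
    (h : (quasiRegularTree d k).Adj v w) :
    (quasiRegularTree d k).Adj (conjFun f a v) (conjFun f a w) := by
  have ha' : ∀ v ∈ f.toPartialEquiv.sourceᶜ, a.1 v = v := fun v hv => ha v (Or.inl hv)
  by_cases hv : v ∈ f.toPartialEquiv.target
  · by_cases hw : w ∈ f.toPartialEquiv.target
    · have hv' := f.toPartialEquiv.map_target hv
      have hw' := f.toPartialEquiv.map_target hw
      rw [conjFun_apply_of_mem f a hv, conjFun_apply_of_mem f a hw,
        f.adj_iff _ (map_mem_source f a ha' hv') _ (map_mem_source f a ha' hw'),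
        a.1.map_adj_iff, ← f.adj_iff _ hv' _ hw', f.toPartialEquiv.right_inv hv,
        f.toPartialEquiv.right_inv hw]
      exact h
    · rw [conjFun_apply_of_notMem f a hw, conjFun_adj_aux f a ha hw h.symm]
      exact h
  · rw [conjFun_apply_of_notMem f a hv, conjFun_adj_aux f a ha hv h]
    exact h

theorem exists_conj (g : NeretinGroup d k) {F : Set (TreeVertex d k)} (hF : F.Finite) :
    ∃ F' : Set (TreeVertex d k), F'.Finite ∧ ∀ a : RootedTreeAut d k, (∀ v ∈ F', a.1 v = v) →
      ∃ b : RootedTreeAut d k, (∀ v ∈ F, b.1 v = v) ∧ g * ofAut d k a * g⁻¹ = ofAut d k b := by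
  obtain ⟨f⟩ := g
  refine ⟨conjSet f F, finite_conjSet f hF, fun a ha => ?_⟩
  have hi : ∀ v ∈ conjSet f F, (a⁻¹).1 v = v := fun v hv => inv_fix a (ha v hv)
  have h1 := conjFun_inv f a fun v hv => ha v (Or.inl hv)
  have h2 := conjFun_inv f a⁻¹ fun v hv => hi v (Or.inl hv)
  rw [inv_inv] at h2
  let b : quasiRegularTree d k ≃g quasiRegularTree d k :=
    { toFun := conjFun f a
      invFun := conjFun f a⁻¹
      left_inv := h1
      right_inv := h2
      map_rel_iff' := by
        intro v w
        refine ⟨fun h => ?_, conjFun_adj f a ha⟩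
        have := conjFun_adj f a⁻¹ hi h
        change (quasiRegularTree d k).Adj (conjFun f a⁻¹ (conjFun f a v))
          (conjFun f a⁻¹ (conjFun f a w)) at this
        rwa [h1, h1] at this }
  have hr : b (root d k) = root d k :=
    conjFun_apply_of_notMem f a fun h => f.target_subtree.root_mem h
  refine ⟨⟨b, hr⟩, fun v hv => conjFun_fix f a ha (Or.inl hv), ?_⟩
  refine mk_eq_mk_of_finite f.target_subtree.finite fun w hw => ?_
  exact (conjFun_apply_of_mem f a (not_not.1 hw)).symm

/-- The sets `g • Fix(F)` are open. -/
theorem isOpen_coset (g : NeretinGroup d k) {F : Set (TreeVertex d k)} (hF : F.Finite) :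
    IsOpen {h | ∃ a : RootedTreeAut d k, (∀ v ∈ F, a.1 v = v) ∧ h = g * ofAut d k a} := by
  rintro h ⟨a, ha, rfl⟩
  refine ⟨F, hF, fun b hb => ⟨a * b, fun v hv => ?_, ?_⟩⟩
  · change a.1 (b.1 v) = v
    rw [hb v hv, ha v hv]
  · rw [map_mul, mul_assoc]

open scoped Topology in
theorem mem_nhds_iff' {g : NeretinGroup d k} {U : Set (NeretinGroup d k)} :
    U ∈ 𝓝 g ↔ ∃ F : Set (TreeVertex d k), F.Finite ∧
      ∀ a : RootedTreeAut d k, (∀ v ∈ F, a.1 v = v) → g * ofAut d k a ∈ U := by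
  rw [mem_nhds_iff]
  constructor
  · rintro ⟨V, hVU, hV, hg⟩
    obtain ⟨F, hF, h⟩ := hV g hg
    exact ⟨F, hF, fun a ha => hVU (h a ha)⟩
  · rintro ⟨F, hF, h⟩
    refine ⟨_, ?_, isOpen_coset g hF, 1, fun _ _ => rfl, by rw [map_one, mul_one]⟩
    rintro _ ⟨a, ha, rfl⟩
    exact h a ha

instance : IsTopologicalGroup (NeretinGroup d k) where
  continuous_mul := by
    rw [continuous_iff_continuousAt]
    rintro ⟨g, h⟩ U hU
    obtain ⟨F, hF, hFU⟩ := mem_nhds_iff'.1 hU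
    obtain ⟨F', hF', hc⟩ := exists_conj h⁻¹ hF
    refine Filter.mem_map.2 (Filter.mem_of_superset (prod_mem_nhds
      ((isOpen_coset g hF').mem_nhds ⟨1, fun _ _ => rfl, by rw [map_one, mul_one]⟩)
      ((isOpen_coset h hF).mem_nhds ⟨1, fun _ _ => rfl, by rw [map_one, mul_one]⟩)) ?_)
    rintro ⟨_, _⟩ ⟨⟨a, ha, rfl⟩, ⟨b, hb, rfl⟩⟩
    obtain ⟨c, hc, hac⟩ := hc a ha
    have : g * ofAut d k a * (h * ofAut d k b) = g * h * ofAut d k (c * b) := by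
      rw [map_mul, ← hac]
      group
    change g * ofAut d k a * (h * ofAut d k b) ∈ U
    rw [this]
    refine hFU _ fun v hv => ?_
    change c.1 (b.1 v) = v
    rw [hb v hv, hc v hv]
  continuous_inv := by
    rw [continuous_iff_continuousAt]
    intro g U hU
    obtain ⟨F, hF, hFU⟩ := mem_nhds_iff'.1 hU
    obtain ⟨F', hF', hc⟩ := exists_conj g hF
    refine mem_nhds_iff'.2 ⟨F', hF', fun a ha => ?_⟩
    obtain ⟨c, hc, hac⟩ := hc a ha
    have : (g * ofAut d k a)⁻¹ = g⁻¹ * ofAut d k c⁻¹ := by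
      rw [map_inv, ← hac]
      group
    change (g * ofAut d k a)⁻¹ ∈ U
    rw [this]
    exact hFU _ fun v hv => inv_fix c (hc v hv)

end NeretinGroup

/-! ## The Chabauty space -/

/-- The Chabauty topology on the set `Sub(G)` of closed subgroups of `G`: it is generated by the
sets `{H | H ∩ K = ∅}` with `K` compact and `{H | H ∩ U ≠ ∅}` with `U` open. -/
instance chabautyTopology (G : Type*) [Group G] [TopologicalSpace G] :
    TopologicalSpace (ClosedSubgroup G) :=
  TopologicalSpace.generateFrom
    ({S | ∃ K : Set G, IsCompact K ∧ S = {H : ClosedSubgroup G | (H : Set G) ∩ K = ∅}} ∪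
      {S | ∃ U : Set G, IsOpen U ∧ S = {H : ClosedSubgroup G | ((H : Set G) ∩ U).Nonempty}})

/-- The group `G` itself, as a point of its Chabauty space `Sub(G)`. -/
def ClosedSubgroup.whole (G : Type*) [Group G] [TopologicalSpace G] : ClosedSubgroup G :=
  ⟨⊤, isClosed_univ⟩

/-! For a finite rooted subtree `A`, let its leaves be the vertices outside `A` with parent in `A`.
A forest isomorphism `T ∖ A → T ∖ B` maps the leaves of `A` bijectively to those of `B`, and every
bijection of leaves extends to such an isomorphism. Call a subgroup `H` full at level `m` (`IsFull`)
if for all `A`, `B` with `m` vertices some element of `H` maps `T ∖ A` to `T ∖ B`, and every 3-cycle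
of leaves of `A` is induced by an element of `H`. There are finitely many subtrees with `m`
vertices, and each requirement says that `H` meets some open set. So fullness at level `m` is an
open condition (`isOpen_setOf_isFull`), and the whole group satisfies it. It remains to see that,
for large `m`, no other closed subgroup does.

Fullness climbs from `m` to `m + 1` (`IsFull.succ`). Let `c ≠ c'` be leaves of a tree `B` with `m -
1` vertices. A 3-cycle of leaves of `B ∪ {c'}` fixing `c` acts on the leaves of `B ∪ {c, c'}` as
this 3-cycle times an unknown permutation of the `d` children of `c`. Only `d!` errors are possible,
so among many 3-cycles `(x y z)` two have the same error, and their quotient is a genuine 3-cycle in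
`H`; conjugation yields all 3-cycles avoiding the children of `c` (`cycle₃_mem_of_mul_mem`). The
same holds for `c'`, and the two families together generate all 3-cycles of leaves. Elements of `H`
carry this to every other tree with `m + 1` vertices.

Finally, a full subgroup is dense (`IsFull.mem`). On a large tree, `H` realizes every bijection of
leaves up to an odd permutation. The parity is corrected by swapping two sibling leaves, which an
automorphism fixing the tree pointwise can do. -/

/-! ### Generating permutations by 3-cycles -/

section ThreeCycles

open Equiv Equiv.Perm

variable {α : Type*}

theorem finite_setOf_perm_fixing_compl {C : Set α} (hC : C.Finite) :
    {τ : Perm α | ∀ v ∉ C, τ v = v}.Finite := by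
  classical
  have := hC.to_subtype
  exact Finite.of_equiv _ (Perm.subtypeEquivSubtypePerm (· ∈ C))

theorem ncard_setOf_perm_fixing_compl {C : Set α} (hC : C.Finite) :
    {τ : Perm α | ∀ v ∉ C, τ v = v}.ncard = C.ncard.factorial := by
  classical
  have := hC.to_subtype
  rw [← Nat.card_coe_set_eq, ← Nat.card_coe_set_eq C, ← Nat.card_perm]
  exact Nat.card_congr (Perm.subtypeEquivSubtypePerm (· ∈ C)).symm

variable [DecidableEq α]

/-- The permutation `x ↦ y ↦ z ↦ x` (for distinct `x`, `y`, `z`). -/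
def cycle₃ (x y z : α) : Perm α := swap x y * swap y z

theorem cycle₃_apply_of_ne {x y z v : α} (hx : v ≠ x) (hy : v ≠ y) (hz : v ≠ z) :
    cycle₃ x y z v = v := by
  simp [cycle₃, swap_apply_of_ne_of_ne, *]

theorem cycle₃_apply_left {x y z : α} (hxy : x ≠ y) (hxz : x ≠ z) : cycle₃ x y z x = y := by
  simp [cycle₃, swap_apply_of_ne_of_ne, *]

theorem cycle₃_apply_mid {x y z : α} (hxz : x ≠ z) (hyz : y ≠ z) : cycle₃ x y z y = z := by
  simp [cycle₃, swap_apply_of_ne_of_ne hxz.symm hyz.symm]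

theorem cycle₃_apply_right {x y z : α} : cycle₃ x y z z = x := by
  simp [cycle₃]

theorem cycle₃_conj (g : Perm α) (x y z : α) :
    cycle₃ (g x) (g y) (g z) = g * cycle₃ x y z * g⁻¹ := by
  simp only [cycle₃, swap_apply_apply]
  group

/-- This quotient eliminates `b`. It drives both the generation from a star of 3-cycles and the
cancellation of a common error factor. -/
theorem cycle₃_mul_inv {a b x y : α} (hab : a ≠ b) (hax : a ≠ x) (hay : a ≠ y) (hbx : b ≠ x)
    (hby : b ≠ y) (hxy : x ≠ y) : cycle₃ a b x * (cycle₃ a b y)⁻¹ = cycle₃ a y x := by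
  rw [mul_inv_eq_iff_eq_mul]
  ext v
  simp only [cycle₃, Perm.mul_apply, swap_apply_def]
  grind

/-- If `Γ` contains all the `3`-cycles `(a b y)` with `y ∈ Y`, it contains all `3`-cycles on `Y`. -/
theorem cycle₃_mem_of_star {Γ : Subgroup (Perm α)} {Y : Set α} {a b : α} (hb : b ∈ Y)
    (hab : a ≠ b) (h : ∀ y ∈ Y, y ≠ a → y ≠ b → cycle₃ a b y ∈ Γ) {x y z : α} (hx : x ∈ Y)
    (hy : y ∈ Y) (hz : z ∈ Y) (hxy : x ≠ y) (hxz : x ≠ z) (hyz : y ≠ z) : cycle₃ x y z ∈ Γ := by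
  have rot : ∀ x y z : α, x ≠ y → x ≠ z → y ≠ z → cycle₃ x y z = cycle₃ y z x := by
    intro x y z h1 h2 h3
    ext v
    simp only [cycle₃, Perm.mul_apply, swap_apply_def]
    grind
  have inv : ∀ x y z : α, x ≠ y → x ≠ z → y ≠ z → (cycle₃ x y z)⁻¹ = cycle₃ z y x := by
    intro x y z _ _ _
    rw [cycle₃, cycle₃, mul_inv_rev, swap_inv, swap_inv, swap_comm y z, swap_comm x y]
  -- 3-cycles through `a` are quotients of two cycles of the star, or cycles of the star up to
  -- inversion.
  have h1 : ∀ x ∈ Y, ∀ y ∈ Y, x ≠ a → y ≠ a → x ≠ y → cycle₃ a y x ∈ Γ := by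
    intro x hx y hy hxa hya hxy
    by_cases hxb : x = b
    · subst hxb
      rw [← inv_mem_iff, inv _ _ _ hya.symm hab hxy.symm, ← rot _ _ _ hab hya.symm hxy]
      exact h y hy hya hxy.symm
    by_cases hyb : y = b
    · subst hyb
      exact h x hx hxa hxb
    rw [← cycle₃_mul_inv hab hxa.symm hya.symm (Ne.symm hxb) (Ne.symm hyb) hxy]
    exact mul_mem (h x hx hxa hxb) (inv_mem (h y hy hya hyb))
  by_cases hxa : x = a
  · subst hxa; exact h1 _ hz _ hy hxz.symm hxy.symm hyz.symm
  by_cases hya : y = a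
  · subst hya
    rw [rot _ _ _ hxy hxz hyz]
    exact h1 _ hx _ hz hxa hyz.symm hxz
  by_cases hza : z = a
  · subst hza
    rw [← rot _ _ _ (Ne.symm hxa) (Ne.symm hya) hxy]
    exact h1 _ hy _ hx hya hxa hxy.symm
  -- A 3-cycle avoiding `a` is the quotient of `(x a z)` by `(x a y)`, which both pass through `a`.
  rw [← cycle₃_mul_inv hxa hxz hxy (Ne.symm hza) (Ne.symm hya) hyz.symm,
    rot _ _ _ hxa hxz (Ne.symm hza), rot _ _ _ hxa hxy (Ne.symm hya)]
  exact mul_mem (h1 x hx z hz hxa hza hxz) (inv_mem (h1 x hx y hy hxa hya hxy))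

/-- If every `3`-cycle on `X` lies in `Γ` up to a factor in a small set `T` of permutations
fixing `X` pointwise, then every `3`-cycle on `X` lies in `Γ`. -/
theorem cycle₃_mem_of_mul_mem {Γ : Subgroup (Perm α)} {X : Set α} {T : Set (Perm α)}
    (hT : T.Finite) (hTX : ∀ τ ∈ T, ∀ v ∈ X, τ v = v)
    (hcard : T.ncard + 4 < X.ncard)
    (h : ∀ x ∈ X, ∀ y ∈ X, ∀ z ∈ X, x ≠ y → x ≠ z → y ≠ z → ∃ τ ∈ T, cycle₃ x y z * τ ∈ Γ)
    {x p q : α} (hx : x ∈ X) (hp : p ∈ X) (hq : q ∈ X) (hxp : x ≠ p) (hxq : x ≠ q)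
    (hpq : p ≠ q) : cycle₃ x p q ∈ Γ := by
  have hlt : ({x, p, q} : Set α).ncard < X.ncard := by
    have := Set.ncard_insert_le x {p, q}
    have := Set.ncard_insert_le p {q}
    have := Set.ncard_singleton q
    omega
  obtain ⟨y, hy, hy'⟩ := Set.exists_mem_notMem_of_ncard_lt_ncard hlt (by simp)
  simp only [mem_insert_iff, mem_singleton_iff, not_or] at hy'
  obtain ⟨hyx, hyp, hyq⟩ := hy'
  let Z : Set α := X \ {x, p, q, y}
  -- The summand 4 in `hcard` pays for the points `x`, `p`, `q`, `y`.
  have hZ : T.ncard < Z.ncard := by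
    have h0 := Set.le_ncard_sdiff {x, p, q, y} X (by simp)
    have := Set.ncard_insert_le x {p, q, y}
    have := Set.ncard_insert_le p {q, y}
    have := Set.ncard_insert_le q {y}
    have := Set.ncard_singleton y
    change _ ≤ Z.ncard at h0
    omega
  have hZ' : ∀ z ∈ Z, z ∈ X ∧ z ≠ x ∧ z ≠ p ∧ z ≠ q ∧ z ≠ y := by
    rintro z ⟨hz, hz'⟩
    simp only [mem_insert_iff, mem_singleton_iff, not_or] at hz'
    exact ⟨hz, hz'⟩
  have hex : ∀ z, ∃ τ, z ∈ Z → τ ∈ T ∧ cycle₃ x y z * τ ∈ Γ := by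
    intro z
    by_cases hz : z ∈ Z
    · obtain ⟨hz1, hz2, -, -, hz3⟩ := hZ' z hz
      obtain ⟨τ, h1, h2⟩ := h x hx y hy z hz1 (Ne.symm hyx) hz2.symm hz3.symm
      exact ⟨τ, fun _ => ⟨h1, h2⟩⟩
    · exact ⟨1, fun h => absurd h hz⟩
  choose t ht using hex
  -- Pigeonhole: the cycles `(x y z)` and `(x y z')` have the same error, which cancels in the
  -- quotient `(x z' z)`.
  obtain ⟨z, hz, z', hz', hzz, htz⟩ := Set.exists_ne_map_eq_of_ncard_lt_of_maps_to hZ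
    (fun z hz => (ht z hz).1) hT
  obtain ⟨hz1, hz2, hz3, hz4, hz5⟩ := hZ' z hz
  obtain ⟨hz1', hz2', hz3', hz4', hz5'⟩ := hZ' z' hz'
  have h1 : cycle₃ x z' z ∈ Γ := by
    have := mul_mem (ht z hz).2 (inv_mem (ht z' hz').2)
    rw [htz, mul_inv_rev, mul_assoc, mul_inv_cancel_left,
      cycle₃_mul_inv (Ne.symm hyx) hz2.symm hz2'.symm hz5.symm hz5'.symm hzz] at this
    exact this
  -- Errors are harmless in conjugating elements, as they fix `X` pointwise. Conjugation by `(z' p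
  -- y) τ` turns `(x z' z)` into `(x p z)`; below, `(z q y) τ` turns this into `(x p q)`.
  obtain ⟨τ, hτ, hg⟩ := h z' hz1' p hp y hy hz3' hz5' (Ne.symm hyp)
  have h2 : cycle₃ x p z ∈ Γ := by
    have := mul_mem (mul_mem hg h1) (inv_mem hg)
    rw [← cycle₃_conj] at this
    simp only [Perm.mul_apply, hTX τ hτ _ hx, hTX τ hτ _ hz1, hTX τ hτ _ hz1'] at this
    rwa [cycle₃_apply_of_ne hz2'.symm hxp (Ne.symm hyx), cycle₃_apply_left hz3' hz5',
      cycle₃_apply_of_ne hzz hz3 hz5] at this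
  obtain ⟨τ, hτ, hg⟩ := h z hz1 q hq y hy hz4 hz5 (Ne.symm hyq)
  have := mul_mem (mul_mem hg h2) (inv_mem hg)
  rw [← cycle₃_conj] at this
  simp only [Perm.mul_apply, hTX τ hτ _ hx, hTX τ hτ _ hz1, hTX τ hτ _ hp] at this
  rwa [cycle₃_apply_of_ne hz2.symm hxq (Ne.symm hyx), cycle₃_apply_left hz4 hz5,
      cycle₃_apply_of_ne hz3.symm hpq (Ne.symm hyp)] at this

/-- If `Γ` contains all `3`-cycles on `Y`, it contains one of `σ` and `(p q) σ` for every
permutation `σ` supported on a finite subset of `Y`. -/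
theorem mem_or_swap_mul_mem {Γ : Subgroup (Perm α)} {Y : Set α}
    (h : ∀ x ∈ Y, ∀ y ∈ Y, ∀ z ∈ Y, x ≠ y → x ≠ z → y ≠ z → cycle₃ x y z ∈ Γ) {p q : α}
    (hp : p ∈ Y) (hq : q ∈ Y) (hpq : p ≠ q) (hY : Y.Finite) (σ : Perm α)
    (hσ : ∀ v ∉ Y, σ v = v) : σ ∈ Γ ∨ swap p q * σ ∈ Γ := by
  have h3 : ∀ x ∈ Y, ∀ y ∈ Y, ∀ z ∈ Y, x ≠ y → y ≠ z → swap x y * swap y z ∈ Γ := by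
    intro x hx y hy z hz hxy hyz
    by_cases hxz : x = z
    · rw [hxz, swap_comm z y, swap_mul_self]
      exact one_mem _
    · exact h x hx y hy z hz hxy hxz hyz
  -- If `y ≠ z`, insert `(y z)` twice: `(x y)(z w) = (x y)(y z) · (y z)(z w)`.
  have h4 : ∀ x ∈ Y, ∀ y ∈ Y, ∀ z ∈ Y, ∀ w ∈ Y, x ≠ y → z ≠ w → swap x y * swap z w ∈ Γ := by
    intro x hx y hy z hz w hw hxy hzw
    by_cases hyz : y = z
    · subst hyz
      exact h3 x hx y hy w hw hxy hzw
    · have := mul_mem (h3 x hx y hy z hz hxy hyz) (h3 y hy z hz w hw hyz hzw)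
      rwa [mul_assoc, swap_mul_self_mul] at this
  have key : ∀ S : Finset α, (S : Set α) ⊆ Y → ∀ σ : Perm α, (∀ v ∉ S, σ v = v) →
      σ ∈ Γ ∨ swap p q * σ ∈ Γ := by
    intro S
    induction S using Finset.induction_on with
    | empty =>
      intro _ σ hσ
      have : σ = 1 := Equiv.ext fun v => hσ v (by simp)
      exact Or.inl (this ▸ one_mem _)
    | insert x S hxS ih =>
      intro hS σ hσ
      rw [Finset.coe_insert, insert_subset_iff] at hS
      by_cases hx : σ x = x
      · refine ih hS.2 σ fun v hv => ?_
        by_cases hvx : v = x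
        · rw [hvx, hx]
        · exact hσ v (by simp [hvx, hv])
      have hσx : σ x ∈ Y := by
        by_contra hc
        have : σ x ∉ insert x S := fun hm => by
          rcases Finset.mem_insert.1 hm with hm | hm
          · exact hx hm
          · exact hc (hS.2 hm)
        exact hx (σ.injective (hσ _ this))
      -- One transposition removes `x` from the support and flips the parity, so the two
      -- alternatives are exchanged below.
      have hσ' : ∀ v ∉ S, (swap x (σ x) * σ) v = v := by
        intro v hv
        rw [Perm.mul_apply]
        by_cases hvx : v = x
        · rw [hvx, swap_apply_right]
        · have hv' := hσ v (by simp [hvx, hv])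
          rw [hv', swap_apply_of_ne_of_ne hvx]
          intro hc
          rw [← hv'] at hc
          exact hvx (σ.injective hc)
      rcases ih hS.2 _ hσ' with h1 | h1
      · right
        have := mul_mem (h4 p hp q hq x hS.1 _ hσx hpq (Ne.symm hx)) h1
        rwa [mul_assoc, swap_mul_self_mul] at this
      · left
        have := mul_mem (h4 x hS.1 _ hσx p hp q hq (Ne.symm hx) hpq) h1
        rwa [mul_assoc, swap_mul_self_mul, swap_mul_self_mul] at this
  refine key hY.toFinset (by simp) σ fun v hv => hσ v (by simpa using hv)

end ThreeCycles

/-! ### Finite subtrees and their leaves -/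

namespace TreeVertex

variable {d k : ℕ}

/-- The `j`-th child of a vertex that is not the root. -/
def child (j : Fin d) : TreeVertex d k → TreeVertex d k
  -- Default value: the children of the root are indexed by `Fin k` instead.
  | none => none
  | some (i, w) => some (i, j :: w)

theorem child_mem_children {u : TreeVertex d k} (hu : u ≠ root d k) (j : Fin d) :
    child j u ∈ children u := by
  rcases u with _ | ⟨i, w⟩
  · exact absurd rfl hu
  · exact ⟨by simp [child, root], rfl⟩

theorem exists_eq_child {u v : TreeVertex d k} (hu : u ≠ root d k) (hv : v ∈ children u) :
    ∃ j, v = child j u := by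
  rcases u with _ | ⟨i, w⟩
  · exact absurd rfl hu
  · rw [children_some] at hv
    obtain ⟨j, rfl⟩ := hv
    exact ⟨j, rfl⟩

theorem ncard_children_root : (children (root d k)).ncard = k := by
  have : children (root d k) = range fun i : Fin k => (some (i, []) : TreeVertex d k) := by
    ext v
    rcases v with _ | ⟨i, _ | ⟨j, w⟩⟩ <;> simp [children, root, parent]
  rw [this, ← image_univ, ncard_image_of_injective, ncard_univ, Nat.card_fin]
  intro a b h
  simpa using h

theorem eq_root_of_depth_eq_zero {v : TreeVertex d k} (hv : depth v = 0) : v = root d k := by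
  rcases v with _ | ⟨i, w⟩
  · rfl
  · simp [depth] at hv

theorem finite_setOf_depth_le (n : ℕ) : {v : TreeVertex d k | depth v ≤ n}.Finite := by
  refine (((finite_univ (α := Fin k)).prod (List.finite_length_le (Fin d) n)).image
    some |>.insert none).subset ?_
  rintro (_ | ⟨i, w⟩) hv
  · exact Or.inl rfl
  · refine Or.inr ⟨(i, w), ⟨mem_univ _, ?_⟩, rfl⟩
    change w.length + 1 ≤ n at hv
    change w.length ≤ n
    omega

/-- The leaves of the complete tree with set of inner vertices `A`. -/
def leaves (A : Set (TreeVertex d k)) : Set (TreeVertex d k) := {v | v ∉ A ∧ parent v ∈ A}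

theorem disjoint_leaves_children {A : Set (TreeVertex d k)} {c : TreeVertex d k} (hc : c ∉ A) :
    Disjoint (leaves A) (children c) :=
  disjoint_left.2 fun _ h1 h2 => hc (h2.2 ▸ h1.2)

end TreeVertex

namespace IsFiniteRootedSubtree

variable {d k : ℕ} {A : Set (TreeVertex d k)}

theorem ne_root (hA : IsFiniteRootedSubtree A) {v : TreeVertex d k} (hv : v ∉ A) :
    v ≠ root d k := by
  rintro rfl
  exact hv hA.root_mem

theorem notMem_of_mem_children (hA : IsFiniteRootedSubtree A) {u v : TreeVertex d k} (hu : u ∉ A)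
    (hv : v ∈ children u) : v ∉ A := fun h => hu (hv.2 ▸ hA.parent_mem h)

theorem biUnion_children (hA : IsFiniteRootedSubtree A) :
    ⋃ v ∈ A, children v = A \ {root d k} ∪ leaves A := by
  ext v
  simp only [mem_iUnion, exists_prop, mem_union, mem_sdiff, mem_singleton_iff]
  constructor
  · rintro ⟨u, hu, h, rfl⟩
    by_cases hv : v ∈ A
    · exact Or.inl ⟨hv, h⟩
    · exact Or.inr ⟨hv, hu⟩
  · rintro (⟨h1, h2⟩ | h)
    · exact ⟨_, hA.parent_mem h1, h2, rfl⟩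
    · exact ⟨_, h.2, hA.ne_root h.1, rfl⟩

theorem finite_leaves (hA : IsFiniteRootedSubtree A) : (leaves A).Finite := by
  refine (hA.finite.biUnion fun v _ => finite_children v).subset ?_
  rw [hA.biUnion_children]
  exact subset_union_right

/-- Count the children of vertices of `A` twice: by parents this gives `k + (|A| - 1) d`, and by
position `|A| - 1` in `A` plus the leaves. The terms are moved so that no subtraction of naturals
occurs. -/
theorem ncard_leaves (hA : IsFiniteRootedSubtree A) :
    (leaves A).ncard + A.ncard + d = k + A.ncard * d + 1 := by
  classical
  have h1 : (⋃ v ∈ A, children v).ncard = (A \ {root d k}).ncard + (leaves A).ncard := by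
    rw [hA.biUnion_children]
    exact ncard_union_eq (disjoint_left.2 fun v h1 h2 => h2.1 h1.1)
      (hA.finite.subset sdiff_subset) hA.finite_leaves
  have h2 := ncard_sdiff_singleton_add_one hA.root_mem hA.finite
  let s := hA.finite.toFinset
  have h3 : ⋃ v ∈ A, children v =
      ((s.biUnion fun v => (finite_children v).toFinset : Finset (TreeVertex d k)) :
        Set (TreeVertex d k)) := by
    ext v
    simp [s]
  have hr : root d k ∈ s := hA.finite.mem_toFinset.2 hA.root_mem
  rw [h3, ncard_coe_finset, Finset.card_biUnion, ← Finset.add_sum_erase s _ hr,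
    Finset.sum_congr rfl (g := fun _ => d), Finset.sum_const,
    ← ncard_eq_toFinset_card _ (finite_children _), ncard_children_root, smul_eq_mul] at h1
  · have h4 := Finset.card_erase_add_one hr
    have h5 : s.card = A.ncard := (ncard_eq_toFinset_card A hA.finite).symm
    rw [← h5, ← h4, add_mul]
    omega
  · intro v hv
    rw [← ncard_eq_toFinset_card _ (finite_children _), ncard_children (Finset.ne_of_mem_erase hv)]
  · intro u _ v _ huv
    refine Finset.disjoint_left.2 fun w h1 h2 => huv ?_
    rw [Finite.mem_toFinset] at h1 h2
    exact h1.2.symm.trans h2.2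

/-- If `|A| = n + 1`, there are `k + n (d - 1) ≥ n + 2` leaves. Hence a lower bound on the level
supplies as many leaves as needed. -/
theorem ncard_lt_ncard_leaves (hA : IsFiniteRootedSubtree A) (hd : 2 ≤ d) (hk : 2 ≤ k) :
    A.ncard < (leaves A).ncard := by
  have h := hA.ncard_leaves
  have h1 : 0 < A.ncard := (ncard_pos hA.finite).2 ⟨_, hA.root_mem⟩
  obtain ⟨n, hn⟩ := Nat.exists_eq_add_of_lt h1
  obtain ⟨e, rfl⟩ := Nat.exists_eq_add_of_le hd
  rw [hn] at h ⊢
  have : 0 ≤ n * e := Nat.zero_le _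
  nlinarith

theorem ncard_eq_of_ncard_leaves_eq {B : Set (TreeVertex d k)} (hA : IsFiniteRootedSubtree A)
    (hB : IsFiniteRootedSubtree B) (hd : 2 ≤ d) (h : (leaves A).ncard = (leaves B).ncard) :
    A.ncard = B.ncard := by
  have hA' := hA.ncard_leaves
  have hB' := hB.ncard_leaves
  obtain ⟨e, rfl⟩ := Nat.exists_eq_add_of_le hd
  have : A.ncard * (1 + e) = B.ncard * (1 + e) := by nlinarith
  exact Nat.eq_of_mul_eq_mul_right (by omega) this

/-- The ancestors of `v` lie in `A` and realize all the depths `0, …, depth v`. The bound leaves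
only finitely many trees of given cardinality. -/
theorem depth_lt_ncard (hA : IsFiniteRootedSubtree A) {v : TreeVertex d k} (hv : v ∈ A) :
    depth v < A.ncard := by
  have key : ∀ n, ∀ v ∈ A, depth v = n → ∀ i ≤ n, i ∈ depth '' A := by
    intro n
    induction n with
    | zero =>
      intro v hv hn i hi
      exact ⟨v, hv, by omega⟩
    | succ n ih =>
      intro v hv hn i hi
      have hr : v ≠ root d k := by
        rintro rfl
        simp [depth, root] at hn
      have hp := depth_parent hr
      rcases hi.lt_or_eq with hi | rfl
      · exact ih _ (hA.parent_mem hv) (by omega) i (by omega)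
      · exact ⟨v, hv, hn⟩
  have h1 : ((Finset.range (depth v + 1) : Finset ℕ) : Set ℕ) ⊆ depth '' A := fun i hi =>
    key _ v hv rfl i (by simpa [Nat.lt_succ_iff] using hi)
  have h2 := ncard_le_ncard h1 (hA.finite.image _)
  rw [ncard_coe_finset, Finset.card_range] at h2
  have := ncard_image_le (f := depth) hA.finite
  omega

theorem _root_.finite_setOf_isFiniteRootedSubtree_ncard_eq (d k m : ℕ) :
    {A : Set (TreeVertex d k) | IsFiniteRootedSubtree A ∧ A.ncard = m}.Finite := by
  refine (finite_setOf_depth_le m).finite_subsets.subset ?_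
  rintro A ⟨hA, rfl⟩ v hv
  exact (hA.depth_lt_ncard hv).le

/-- A vertex of maximal depth has no children in `A`, so it can be removed. -/
theorem exists_sdiff_singleton (hA : IsFiniteRootedSubtree A) (h : 2 ≤ A.ncard) :
    ∃ c ∈ A, IsFiniteRootedSubtree (A \ {c}) := by
  obtain ⟨c, hc, hmax⟩ := A.exists_max_image depth hA.finite ⟨_, hA.root_mem⟩
  have hcr : c ≠ root d k := by
    rintro rfl
    have : A ⊆ {root d k} := fun v hv => eq_root_of_depth_eq_zero (Nat.le_zero.1 (hmax v hv))
    have := ncard_le_ncard this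
    rw [ncard_singleton] at this
    omega
  refine ⟨c, hc, of_parent_mem (hA.finite.subset sdiff_subset) ⟨hA.root_mem, Ne.symm hcr⟩ ?_⟩
  rintro v ⟨hv, hvc⟩
  refine ⟨hA.parent_mem hv, ?_⟩
  rintro rfl
  by_cases hr : v = root d k
  · subst hr
    exact hvc rfl
  · have := depth_parent hr
    have := hmax v hv
    omega

theorem mem_leaves_sdiff_singleton (hA : IsFiniteRootedSubtree A) {c : TreeVertex d k}
    (hc : c ∈ A) (hA' : IsFiniteRootedSubtree (A \ {c})) : c ∈ leaves (A \ {c}) :=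
  ⟨fun h => h.2 rfl, hA.parent_mem hc, parent_ne_self (hA'.ne_root fun h => h.2 rfl)⟩

theorem insert_leaf (hA : IsFiniteRootedSubtree A) {c : TreeVertex d k} (hc : c ∈ leaves A) :
    IsFiniteRootedSubtree (insert c A) :=
  of_parent_mem (hA.finite.insert c) (Or.inr hA.root_mem) (by
    rintro v (rfl | hv)
    · exact Or.inr hc.2
    · exact Or.inr (hA.parent_mem hv))

theorem leaves_insert (hA : IsFiniteRootedSubtree A) {c : TreeVertex d k} (hc : c ∈ leaves A) :
    leaves (insert c A) = leaves A \ {c} ∪ children c := by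
  ext v
  constructor
  · rintro ⟨h1, h2⟩
    rw [mem_insert_iff, not_or] at h1
    rcases h2 with h2 | h2
    · exact Or.inr ⟨hA.ne_root h1.2, h2⟩
    · exact Or.inl ⟨⟨h1.2, h2⟩, h1.1⟩
  · rintro (⟨⟨h1, h2⟩, h3⟩ | h)
    · exact ⟨fun h => h.elim h3 h1, Or.inr h2⟩
    · refine ⟨fun h' => ?_, Or.inl h.2⟩
      rcases h' with rfl | h'
      · exact parent_ne_self h.1 h.2
      · exact hA.notMem_of_mem_children hc.1 h h'

theorem compl_induction (hA : IsFiniteRootedSubtree A) {p : TreeVertex d k → Prop}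
    (leaf : ∀ v ∈ leaves A, p v) (step : ∀ u ∉ A, ∀ j, p u → p (child j u)) : ∀ v ∉ A, p v := by
  have key : ∀ n, ∀ v ∉ A, depth v = n → p v := by
    intro n
    induction n with
    | zero => exact fun v hv hn => absurd (eq_root_of_depth_eq_zero hn) (hA.ne_root hv)
    | succ n ih =>
      intro v hv hn
      by_cases hp : parent v ∈ A
      · exact leaf v ⟨hv, hp⟩
      · have hd := depth_parent (hA.ne_root hv)
        obtain ⟨j, hj⟩ := exists_eq_child (hA.ne_root hp) ⟨hA.ne_root hv, rfl⟩
        rw [hj]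
        exact step _ hp j (ih _ hp (by omega))
  exact fun v hv => key _ v hv rfl

end IsFiniteRootedSubtree

/-! ### Extending a bijection between leaves -/

section Extend

variable {d k : ℕ}

open Classical in
/-- The extension of a map defined on the leaves of `A` to the descendants of these leaves. -/
noncomputable def extendAux (A : Set (TreeVertex d k)) (s : TreeVertex d k → TreeVertex d k)
    (i : Fin k) : List (Fin d) → TreeVertex d k
  -- The parent is the root, which always lies in `A`; so such a vertex outside `A` is a leaf.
  | [] => s (some (i, []))
  | j :: w => if some (i, w) ∈ A then s (some (i, j :: w)) else child j (extendAux A s i w)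

/-- The extension of a map defined on the leaves of `A` to the descendants of these leaves. -/
noncomputable def extendLeaves (A : Set (TreeVertex d k)) (s : TreeVertex d k → TreeVertex d k) :
    TreeVertex d k → TreeVertex d k
  | none => none
  | some (i, w) => extendAux A s i w

variable {A B : Set (TreeVertex d k)} {s t : TreeVertex d k → TreeVertex d k}

theorem extendLeaves_of_mem (hA : IsFiniteRootedSubtree A) {v : TreeVertex d k}
    (hv : v ∈ leaves A) : extendLeaves A s v = s v := by
  rcases v with _ | ⟨i, _ | ⟨j, w⟩⟩
  · exact absurd rfl (hA.ne_root hv.1)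
  · rfl
  · exact if_pos hv.2

theorem extendLeaves_child (hA : IsFiniteRootedSubtree A) {u : TreeVertex d k} (hu : u ∉ A)
    (j : Fin d) : extendLeaves A s (child j u) = child j (extendLeaves A s u) := by
  rcases u with _ | ⟨i, w⟩
  · exact absurd rfl (hA.ne_root hu)
  · exact if_neg hu

theorem extendLeaves_notMem (hA : IsFiniteRootedSubtree A) (hB : IsFiniteRootedSubtree B)
    (hs : MapsTo s (leaves A) (leaves B)) : ∀ v ∉ A, extendLeaves A s v ∉ B := by
  refine hA.compl_induction (fun v hv => ?_) fun u hu j ih => ?_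
  · rw [extendLeaves_of_mem hA hv]
    exact (hs hv).1
  · rw [extendLeaves_child hA hu]
    exact hB.notMem_of_mem_children ih (child_mem_children (hB.ne_root ih) j)

theorem extendLeaves_leftInv (hA : IsFiniteRootedSubtree A) (hB : IsFiniteRootedSubtree B)
    (hs : MapsTo s (leaves A) (leaves B)) (h : LeftInvOn t s (leaves A)) :
    ∀ v ∉ A, extendLeaves B t (extendLeaves A s v) = v := by
  refine hA.compl_induction (fun v hv => ?_) fun u hu j ih => ?_
  · rw [extendLeaves_of_mem hA hv, extendLeaves_of_mem hB (hs hv), h hv]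
  · rw [extendLeaves_child hA hu, extendLeaves_child hB (extendLeaves_notMem hA hB hs u hu), ih]

theorem extendLeaves_adj (hA : IsFiniteRootedSubtree A) (hB : IsFiniteRootedSubtree B)
    (hs : MapsTo s (leaves A) (leaves B)) {v w : TreeVertex d k} (hv : v ∉ A) (hw : w ∉ A)
    (h : (quasiRegularTree d k).Adj v w) :
    (quasiRegularTree d k).Adj (extendLeaves A s v) (extendLeaves A s w) := by
  have key : ∀ v ∉ A, ∀ w ∈ children v, extendLeaves A s w ∈ children (extendLeaves A s v) := by
    intro v hv w hw
    obtain ⟨j, rfl⟩ := exists_eq_child (hA.ne_root hv) hw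
    rw [extendLeaves_child hA hv]
    exact child_mem_children (hB.ne_root (extendLeaves_notMem hA hB hs v hv)) j
  exact h.imp (key v hv w) (key w hw v)

end Extend

/-! ### Almost automorphisms with prescribed source and target -/

namespace AlmostAut

variable {d k : ℕ}

/-- `f` is an isomorphism of forests from the complement of `A` to the complement of `B`. -/
structure IsMap (f : AlmostAut d k) (A B : Set (TreeVertex d k)) : Prop where
  source_eq : f.toPartialEquiv.source = Aᶜ
  target_eq : f.toPartialEquiv.target = Bᶜ

variable {f g : AlmostAut d k} {A B C : Set (TreeVertex d k)}

/-- The identity map of the complement of `A`. -/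
def idOn (hA : IsFiniteRootedSubtree A) : AlmostAut d k where
  toPartialEquiv := PartialEquiv.ofSet Aᶜ
  source_subtree := by simpa using hA
  target_subtree := by simpa using hA
  adj_iff _ _ _ _ := Iff.rfl

/-- Below each leaf hangs a copy of the same `d`-ary tree, so a bijection of leaves extends by
keeping the labels of the paths below them. The inverse is extended in the same way. -/
theorem exists_isMap_extending (hA : IsFiniteRootedSubtree A) (hB : IsFiniteRootedSubtree B)
    {s : TreeVertex d k → TreeVertex d k} (h : BijOn s (leaves A) (leaves B)) :
    ∃ f : AlmostAut d k, f.IsMap A B ∧ ∀ v ∈ leaves A, f.toPartialEquiv v = s v := by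
  have hs := h.mapsTo
  let t := Function.invFunOn s (leaves A)
  have ht : MapsTo t (leaves B) (leaves A) := h.surjOn.mapsTo_invFunOn
  have h1 := extendLeaves_leftInv hA hB hs h.invOn_invFunOn.1
  have h2 := extendLeaves_leftInv hB hA ht h.invOn_invFunOn.2
  refine ⟨{
    toPartialEquiv :=
      { toFun := extendLeaves A s
        invFun := extendLeaves B t
        source := Aᶜ
        target := Bᶜ
        map_source' := extendLeaves_notMem hA hB hs
        map_target' := extendLeaves_notMem hB hA ht
        left_inv' := h1
        right_inv' := h2 }
    source_subtree := by rwa [compl_compl]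
    target_subtree := by rwa [compl_compl]
    adj_iff := fun v hv w hw => ⟨fun h => ?_, extendLeaves_adj hA hB hs hv hw⟩ },
    ⟨rfl, rfl⟩, fun v hv => extendLeaves_of_mem hA hv⟩
  have := extendLeaves_adj hB hA ht (extendLeaves_notMem hA hB hs v hv)
    (extendLeaves_notMem hA hB hs w hw) h
  rwa [h1 v hv, h1 w hw] at this

namespace IsMap

theorem left (h : f.IsMap A B) : IsFiniteRootedSubtree A := by
  simpa [h.source_eq] using f.source_subtree

theorem right (h : f.IsMap A B) : IsFiniteRootedSubtree B := by
  simpa [h.target_eq] using f.target_subtree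

theorem symm (h : f.IsMap A B) : f.symm.IsMap B A := ⟨h.target_eq, h.source_eq⟩

theorem trans (hf : f.IsMap A B) (hg : g.IsMap B C) : (f.trans g).IsMap A C := by
  have h : f.toPartialEquiv.target = g.toPartialEquiv.source := hf.target_eq.trans hg.source_eq.symm
  constructor
  · change (f.toPartialEquiv.trans g.toPartialEquiv).source = _
    rw [PartialEquiv.trans_source, ← h, ← hf.source_eq]
    exact inter_eq_left.2 f.toPartialEquiv.mapsTo
  · change (f.toPartialEquiv.trans g.toPartialEquiv).target = _
    rw [PartialEquiv.trans_target, h, ← hg.target_eq]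
    exact inter_eq_left.2 g.toPartialEquiv.mapsTo_symm

theorem left_inv (h : f.IsMap A B) {v : TreeVertex d k} (hv : v ∉ A) :
    f.toPartialEquiv.symm (f.toPartialEquiv v) = v :=
  f.toPartialEquiv.left_inv (by rwa [h.source_eq])

theorem right_inv (h : f.IsMap A B) {v : TreeVertex d k} (hv : v ∉ B) :
    f.toPartialEquiv (f.toPartialEquiv.symm v) = v :=
  h.symm.left_inv hv

theorem notMem (h : f.IsMap A B) {v : TreeVertex d k} (hv : v ∉ A) : f.toPartialEquiv v ∉ B := by
  have : v ∈ f.toPartialEquiv.source := by rwa [h.source_eq]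
  have := f.toPartialEquiv.map_source this
  rwa [h.target_eq] at this

/-- Leaves are the roots of the components of the forest, which `parent_mem_target_iff` recognizes
by their valency. -/
theorem mapsTo_leaves (h : f.IsMap A B) : MapsTo f.toPartialEquiv (leaves A) (leaves B) := by
  intro v hv
  refine ⟨h.notMem hv.1, ?_⟩
  have := f.parent_mem_target_iff (v := v) (by rw [h.source_eq]; exact hv.1)
  rw [h.source_eq, h.target_eq, mem_compl_iff, mem_compl_iff, not_iff_not] at this
  exact this.2 hv.2

theorem bijOn_leaves (h : f.IsMap A B) : BijOn f.toPartialEquiv (leaves A) (leaves B) :=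
  BijOn.mk h.mapsTo_leaves
    (f.toPartialEquiv.injOn.mono fun v hv => by rw [h.source_eq]; exact hv.1)
    fun v hv => ⟨f.symm.toPartialEquiv v, h.symm.mapsTo_leaves hv, h.right_inv hv.1⟩

theorem ncard_eq (h : f.IsMap A B) (hd : 2 ≤ d) : A.ncard = B.ncard :=
  h.left.ncard_eq_of_ncard_leaves_eq h.right hd
    (by rw [← h.bijOn_leaves.image_eq, h.bijOn_leaves.injOn.ncard_image])

theorem mapsTo_children (h : f.IsMap A B) {c : TreeVertex d k} (hc : c ∉ A) :
    MapsTo f.toPartialEquiv (children c) (children (f.toPartialEquiv c)) := by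
  intro v hv
  refine ⟨h.right.ne_root (h.notMem (h.left.notMem_of_mem_children hc hv)), ?_⟩
  rw [f.parent_apply (by rw [h.source_eq, hv.2]; exact hc), hv.2]

/-- A forest isomorphism `T ∖ A → T ∖ B` can be restricted to the complement of a larger tree. -/
theorem exists_restrict (h : f.IsMap A B) {A' : Set (TreeVertex d k)}
    (hA' : IsFiniteRootedSubtree A') (hAA' : A ⊆ A') : ∃ (B' : _) (f' : AlmostAut d k),
      f'.IsMap A' B' ∧ (∀ v, v ∈ B' ↔ v ∈ B ∨ f.toPartialEquiv.symm v ∈ A') ∧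
      (∀ v, f'.toPartialEquiv v = f.toPartialEquiv v) ∧ NeretinGroup.mk f' = NeretinGroup.mk f := by
  let i := idOn hA'
  have hv : ∀ v, (i.trans f).toPartialEquiv v = f.toPartialEquiv v := fun _ => rfl
  refine ⟨(i.trans f).toPartialEquiv.targetᶜ, i.trans f, ⟨?_, (compl_compl _).symm⟩, fun v => ?_,
    hv, NeretinGroup.mk_eq_mk_of_finite finite_empty fun v _ => hv v⟩
  · change ((PartialEquiv.ofSet A'ᶜ).trans f.toPartialEquiv).source = _
    rw [PartialEquiv.trans_source, h.source_eq]
    exact inter_eq_left.2 fun v hv hv' => hv (hAA' hv')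
  · change v ∉ ((PartialEquiv.ofSet A'ᶜ).trans f.toPartialEquiv).target ↔ _
    rw [PartialEquiv.trans_target, h.target_eq]
    simp only [mem_inter_iff, mem_preimage, not_and_or, mem_compl_iff, not_not]
    exact or_congr_right not_not

theorem exists_restrict_insert (h : f.IsMap A B) {c : TreeVertex d k} (hc : c ∈ leaves A) :
    ∃ f' : AlmostAut d k, f'.IsMap (insert c A) (insert (f.toPartialEquiv c) B) ∧
      (∀ v, f'.toPartialEquiv v = f.toPartialEquiv v) ∧ NeretinGroup.mk f' = NeretinGroup.mk f := by
  obtain ⟨B', f', h1, h2, h3, h4⟩ := h.exists_restrict (h.left.insert_leaf hc) (subset_insert _ _)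
  refine ⟨f', ?_, h3, h4⟩
  convert h1
  ext v
  rw [h2, mem_insert_iff, mem_insert_iff]
  by_cases hv : v ∈ B
  · simp [hv]
  · have hv' : f.toPartialEquiv.symm v ∉ A := h.symm.notMem hv
    simp only [hv, or_false, hv', false_or]
    constructor
    · rintro rfl
      exact h.left_inv hc.1
    · rintro rfl
      exact (h.right_inv hv).symm

/-- A forest isomorphism `T ∖ A → T ∖ A` which does not change the parents of the leaves of `A`
is induced by an automorphism fixing `A` pointwise. -/
theorem exists_eq_ofAut (h : f.IsMap A A)
    (hp : ∀ v ∈ leaves A, parent (f.toPartialEquiv v) = parent v) :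
    ∃ a : RootedTreeAut d k, (∀ v ∈ A, a.1 v = v) ∧
      NeretinGroup.ofAut d k a = NeretinGroup.mk f := by
  classical
  -- Extend by the identity on `A`. Only edges between `A` and its leaves need the hypothesis on
  -- parents.
  have hadj : ∀ g : AlmostAut d k, g.IsMap A A →
      (∀ v ∈ leaves A, parent (g.toPartialEquiv v) = parent v) → ∀ v w,
      (quasiRegularTree d k).Adj v w → (quasiRegularTree d k).Adj
        (if v ∈ A then v else g.toPartialEquiv v) (if w ∈ A then w else g.toPartialEquiv w) := by
    intro g hg hp
    have key : ∀ v, ∀ w ∈ children v, (if w ∈ A then w else g.toPartialEquiv w) ∈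
        children (if v ∈ A then v else g.toPartialEquiv v) := by
      intro v w hw
      by_cases hv : v ∈ A
      · rw [if_pos hv]
        by_cases hw' : w ∈ A
        · rwa [if_pos hw']
        · rw [if_neg hw']
          exact ⟨hg.right.ne_root (hg.notMem hw'), by rw [hp w ⟨hw', hw.2 ▸ hv⟩, hw.2]⟩
      · rw [if_neg hv, if_neg (hg.left.notMem_of_mem_children hv hw)]
        exact hg.mapsTo_children hv hw
    exact fun v w hvw => hvw.imp (key v w) (key w v)
  have hinv : ∀ g : AlmostAut d k, g.IsMap A A → ∀ v,
      (if (if v ∈ A then v else g.toPartialEquiv v) ∈ A then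
        (if v ∈ A then v else g.toPartialEquiv v) else
        g.symm.toPartialEquiv (if v ∈ A then v else g.toPartialEquiv v)) = v := by
    intro g hg v
    by_cases hv : v ∈ A
    · simp only [if_pos hv]
    · simp only [if_neg hv, if_neg (hg.notMem hv)]
      exact hg.left_inv hv
  have hp' : ∀ v ∈ leaves A, parent (f.symm.toPartialEquiv v) = parent v := by
    intro v hv
    rw [← hp _ (h.symm.mapsTo_leaves hv)]
    exact congrArg parent (h.right_inv hv.1)
  let a : quasiRegularTree d k ≃g quasiRegularTree d k :=
    { toFun := fun v => if v ∈ A then v else f.toPartialEquiv v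
      invFun := fun v => if v ∈ A then v else f.symm.toPartialEquiv v
      left_inv := hinv f h
      right_inv := hinv f.symm h.symm
      map_rel_iff' := by
        intro v w
        refine ⟨fun hvw => ?_, hadj f h hp v w⟩
        have := hadj f.symm h.symm hp' _ _ hvw
        have e1 := hinv f h v
        have e2 := hinv f h w
        exact (congrArg₂ (quasiRegularTree d k).Adj e1 e2).mp this }
  have ha : ∀ v ∈ A, a v = v := fun v hv => if_pos hv
  refine ⟨⟨a, ha _ h.left.root_mem⟩, ha, ?_⟩
  exact NeretinGroup.mk_eq_mk_of_finite h.left.finite fun v hv => if_neg hv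

end IsMap

/-- Precomposing with an automorphism that fixes `A` does not change the source and the target. -/
theorem IsMap.ofAut_trans (h : f.IsMap A B) (a : RootedTreeAut d k)
    (ha : ∀ v ∈ A, a.1 v = v) : ((ofAut a).trans f).IsMap A B := by
  have hroot : ∀ v, a.1 v = root d k ↔ v = root d k := fun v =>
    ⟨fun hv => a.1.injective (hv.trans a.2.symm), fun hv => hv.symm ▸ a.2⟩
  constructor
  · change ((ofAut a).toPartialEquiv.trans f.toPartialEquiv).source = _
    rw [PartialEquiv.trans_source, h.source_eq]
    ext v
    constructor
    · rintro ⟨-, hv⟩ hvA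
      refine hv ?_
      change a.1 v ∈ A
      rwa [ha v hvA]
    · intro hv
      refine ⟨h.left.ne_root hv, fun hv' => hv ?_⟩
      change a.1 v ∈ A at hv'
      rwa [← a.1.injective (ha _ hv')]
  · change ((ofAut a).toPartialEquiv.trans f.toPartialEquiv).target = _
    rw [PartialEquiv.trans_target, ← h.target_eq]
    exact inter_eq_left.2 fun v hv => f.ne_root_of_mem (f.toPartialEquiv.map_target hv)

end AlmostAut

namespace AlmostAut

variable {d k : ℕ} {f : AlmostAut d k} {A B : Set (TreeVertex d k)}

/-- Extending by the identity off the leaves places the permutations for all trees in one common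
group, so that different trees can be compared. -/
theorem IsMap.exists_perm (h : f.IsMap A A) : ∃ σ : Equiv.Perm (TreeVertex d k),
    (∀ v ∉ leaves A, σ v = v) ∧ ∀ v ∈ leaves A, σ v = f.toPartialEquiv v := by
  classical
  have hinv : ∀ g : AlmostAut d k, g.IsMap A A → Function.LeftInverse
      (fun v => if v ∈ leaves A then g.symm.toPartialEquiv v else v)
      (fun v => if v ∈ leaves A then g.toPartialEquiv v else v) := by
    intro g hg v
    by_cases hv : v ∈ leaves A
    · simp only [if_pos hv, if_pos (hg.mapsTo_leaves hv)]
      exact hg.left_inv hv.1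
    · simp only [if_neg hv]
  exact ⟨⟨_, _, hinv f h, hinv f.symm h.symm⟩, fun v hv => if_neg hv, fun v hv => if_pos hv⟩

end AlmostAut

/-! ### Permutations of leaves induced by a subgroup -/

namespace NeretinGroup

open AlmostAut

variable {d k : ℕ} {A B : Set (TreeVertex d k)}

theorem mk_trans (f g : AlmostAut d k) : mk (f.trans g) = mk g * mk f := rfl

theorem mk_symm (f : AlmostAut d k) : mk f.symm = (mk f)⁻¹ := rfl

theorem mk_idOn (hA : IsFiniteRootedSubtree A) : mk (idOn hA) = 1 :=
  mk_eq_mk_of_finite finite_empty fun _ _ => rfl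

/-- The permutations of the leaves of `A` that are induced by elements of `H` mapping the forest
`T ∖ A` to itself. -/
def leafGroup (H : Subgroup (NeretinGroup d k)) (hA : IsFiniteRootedSubtree A) :
    Subgroup (Equiv.Perm (TreeVertex d k)) where
  carrier := {σ | (∀ v ∉ leaves A, σ v = v) ∧
    ∃ f : AlmostAut d k, f.IsMap A A ∧ mk f ∈ H ∧ ∀ v ∈ leaves A, f.toPartialEquiv v = σ v}
  one_mem' := ⟨fun _ _ => rfl, idOn hA, ⟨rfl, rfl⟩, mk_idOn hA ▸ one_mem _, fun _ _ => rfl⟩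
  mul_mem' := by
    rintro σ τ ⟨hσ, f, hf, hfH, hfσ⟩ ⟨hτ, g, hg, hgH, hgτ⟩
    refine ⟨fun v hv => ?_, g.trans f, hg.trans hf, mul_mem hfH hgH, fun v hv => ?_⟩
    · rw [Equiv.Perm.mul_apply, hτ v hv, hσ v hv]
    · rw [Equiv.Perm.mul_apply, ← hgτ v hv, ← hfσ _ (hg.mapsTo_leaves hv)]
      rfl
  inv_mem' := by
    rintro σ ⟨hσ, f, hf, hfH, hfσ⟩
    refine ⟨fun v hv => ?_, f.symm, hf.symm, inv_mem hfH, fun v hv => ?_⟩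
    · rw [Equiv.Perm.inv_eq_iff_eq, hσ v hv]
    · rw [Equiv.Perm.eq_inv_iff_eq, ← hfσ _ (hf.symm.mapsTo_leaves hv)]
      exact hf.right_inv hv.1

variable {H : Subgroup (NeretinGroup d k)}

/-- Conjugation by `f`, which lies in `H`, carries one 3-cycle to the other. -/
theorem cycle₃_mem_leafGroup_of_isMap {f : AlmostAut d k} (hA : IsFiniteRootedSubtree A)
    (hB : IsFiniteRootedSubtree B) (hf : f.IsMap A B) (hfH : mk f ∈ H) {x y z : TreeVertex d k}
    (hx : x ∈ leaves A) (hy : y ∈ leaves A) (hz : z ∈ leaves A) (hxy : x ≠ y) (hxz : x ≠ z)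
    (hyz : y ≠ z) (h : cycle₃ (f.toPartialEquiv x) (f.toPartialEquiv y) (f.toPartialEquiv z) ∈
      leafGroup H hB) : cycle₃ x y z ∈ leafGroup H hA := by
  obtain ⟨-, g, hg, hgH, hgσ⟩ := h
  have hinj := hf.bijOn_leaves.injOn
  refine ⟨fun v hv => cycle₃_apply_of_ne (fun e => hv (e ▸ hx)) (fun e => hv (e ▸ hy))
    fun e => hv (e ▸ hz), (f.trans g).trans f.symm, (hf.trans hg).trans hf.symm,
    mul_mem (inv_mem hfH) (mul_mem hgH hfH), fun v hv => ?_⟩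
  change f.symm.toPartialEquiv (g.toPartialEquiv (f.toPartialEquiv v)) = _
  rw [hgσ _ (hf.mapsTo_leaves hv)]
  have hxy' := hinj.ne hx hy hxy
  have hxz' := hinj.ne hx hz hxz
  have hyz' := hinj.ne hy hz hyz
  by_cases h1 : v = x
  · rw [h1, cycle₃_apply_left hxy' hxz', cycle₃_apply_left hxy hxz]
    exact hf.left_inv hy.1
  by_cases h2 : v = y
  · rw [h2, cycle₃_apply_mid hxz' hyz', cycle₃_apply_mid hxz hyz]
    exact hf.left_inv hz.1
  by_cases h3 : v = z
  · rw [h3, cycle₃_apply_right, cycle₃_apply_right]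
    exact hf.left_inv hx.1
  rw [cycle₃_apply_of_ne (hinj.ne hv hx h1) (hinj.ne hv hy h2) (hinj.ne hv hz h3),
    cycle₃_apply_of_ne h1 h2 h3]
  exact hf.left_inv hv.1

/-- All `3`-cycles of leaves of `A` are induced by elements of `H`. -/
def ContainsCycles (H : Subgroup (NeretinGroup d k)) (hA : IsFiniteRootedSubtree A) : Prop :=
  ∀ x ∈ leaves A, ∀ y ∈ leaves A, ∀ z ∈ leaves A, x ≠ y → x ≠ z → y ≠ z →
    cycle₃ x y z ∈ leafGroup H hA

theorem ContainsCycles.of_isMap {f : AlmostAut d k} {hA : IsFiniteRootedSubtree A}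
    {hB : IsFiniteRootedSubtree B} (h : ContainsCycles H hB) (hf : f.IsMap A B)
    (hfH : mk f ∈ H) : ContainsCycles H hA := fun _ hx _ hy _ hz hxy hxz hyz =>
  have hinj := hf.bijOn_leaves.injOn
  cycle₃_mem_leafGroup_of_isMap hA hB hf hfH hx hy hz hxy hxz hyz
    (h _ (hf.mapsTo_leaves hx) _ (hf.mapsTo_leaves hy) _ (hf.mapsTo_leaves hz)
      (hinj.ne hx hy hxy) (hinj.ne hx hz hxz) (hinj.ne hy hz hyz))

/-- A `3`-cycle of leaves of `A` that fixes `c` acts on the leaves of `A ∪ {c}`, up to a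
permutation of the children of `c`. -/
theorem ContainsCycles.exists_mul_mem {hA : IsFiniteRootedSubtree A} (h : ContainsCycles H hA)
    {c : TreeVertex d k} (hc : c ∈ leaves A) {x y z : TreeVertex d k} (hx : x ∈ leaves A \ {c})
    (hy : y ∈ leaves A \ {c}) (hz : z ∈ leaves A \ {c}) (hxy : x ≠ y) (hxz : x ≠ z)
    (hyz : y ≠ z) : ∃ τ : Equiv.Perm (TreeVertex d k), (∀ v ∉ children c, τ v = v) ∧
      cycle₃ x y z * τ ∈ leafGroup H (hA.insert_leaf hc) := by
  obtain ⟨-, f, hf, hfH, hfσ⟩ := h x hx.1 y hy.1 z hz.1 hxy hxz hyz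
  have hfc : f.toPartialEquiv c = c := by
    rw [hfσ c hc, cycle₃_apply_of_ne (Ne.symm hx.2) (Ne.symm hy.2) (Ne.symm hz.2)]
  obtain ⟨f', hf', hff, hmk⟩ := hf.exists_restrict_insert hc
  rw [hfc] at hf'
  obtain ⟨σ, hσ, hσf⟩ := hf'.exists_perm
  have hl := hA.leaves_insert hc
  -- `σ` is the action of the same element on the leaves of `A ∪ {c}`. As `c` is fixed, its children
  -- are permuted among themselves, in an uncontrolled way.
  refine ⟨(cycle₃ x y z)⁻¹ * σ, fun v hv => ?_, ?_⟩
  · rw [Equiv.Perm.mul_apply, Equiv.Perm.inv_eq_iff_eq]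
    by_cases hv' : v ∈ leaves A \ {c}
    · rw [hσf v (hl ▸ Or.inl hv'), hff, hfσ v hv'.1]
    · have hne : ∀ u ∈ leaves A \ {c}, v ≠ u := fun u hu e => hv' (e ▸ hu)
      rw [cycle₃_apply_of_ne (hne x hx) (hne y hy) (hne z hz)]
      exact hσ v (hl ▸ fun h => h.elim hv' hv)
  · rw [mul_inv_cancel_left]
    exact ⟨hσ, f', hf', hmk ▸ hfH, fun v hv => (hσf v hv).symm⟩

/-- The error lies in the group of permutations of the children of `c`, of order `d!`, and fixes the
other leaves; `cycle₃_mem_of_mul_mem` removes it. Of the summand 5, one is for `c` and four come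
from that lemma. -/
theorem ContainsCycles.cycle₃_mem_insert {hA : IsFiniteRootedSubtree A} (h : ContainsCycles H hA)
    {c : TreeVertex d k} (hc : c ∈ leaves A) (hcard : d.factorial + 5 < (leaves A).ncard)
    {x y z : TreeVertex d k} (hx : x ∈ leaves A \ {c})
    (hy : y ∈ leaves A \ {c}) (hz : z ∈ leaves A \ {c}) (hxy : x ≠ y) (hxz : x ≠ z)
    (hyz : y ≠ z) : cycle₃ x y z ∈ leafGroup H (hA.insert_leaf hc) := by
  have hfin := finite_children c
  refine cycle₃_mem_of_mul_mem (finite_setOf_perm_fixing_compl hfin) (X := leaves A \ {c})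
    (fun τ hτ v hv => hτ v fun hv' => (disjoint_leaves_children hc.1).le_bot ⟨hv.1, hv'⟩) ?_
    (fun x hx y hy z hz hxy hxz hyz => h.exists_mul_mem hc hx hy hz hxy hxz hyz)
    hx hy hz hxy hxz hyz
  rw [ncard_setOf_perm_fixing_compl hfin, ncard_children (hA.ne_root hc.1)]
  have := ncard_sdiff_singleton_add_one hc hA.finite_leaves
  omega

/-- If all `3`-cycles of the leaves of `A ∪ {c}` and of `A ∪ {c'}` are induced by elements of `H`,
then so are those of the leaves of `A ∪ {c, c'}`. -/
theorem ContainsCycles.insert_insert {hA : IsFiniteRootedSubtree A} {c c' : TreeVertex d k}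
    (hc : c ∈ leaves A) (hc' : c' ∈ leaves A) (hcc : c ≠ c')
    (h : ContainsCycles H (hA.insert_leaf hc)) (h' : ContainsCycles H (hA.insert_leaf hc'))
    (hd : 2 ≤ d) (hk : 2 ≤ k) (hcard : d.factorial + 2 * d + 5 < A.ncard)
    (hP : IsFiniteRootedSubtree (insert c (insert c' A))) : ContainsCycles H hP := by
  have hc2 : c ∈ leaves (insert c' A) := by
    rw [hA.leaves_insert hc']
    exact Or.inl ⟨hc, hcc⟩
  have hc2' : c' ∈ leaves (insert c A) := by
    rw [hA.leaves_insert hc]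
    exact Or.inl ⟨hc', hcc.symm⟩
  have hcomm : insert c' (insert c A) = insert c (insert c' A) := insert_comm _ _ _
  have hl := (hA.insert_leaf hc').leaves_insert hc2
  have hl' := (hA.insert_leaf hc).leaves_insert hc2'
  rw [hcomm] at hl'
  have n1 := (hA.insert_leaf hc).ncard_lt_ncard_leaves hd hk
  have n2 := (hA.insert_leaf hc').ncard_lt_ncard_leaves hd hk
  have n3 := hP.ncard_lt_ncard_leaves hd hk
  rw [ncard_insert_of_notMem hc.1 hA.finite] at n1
  rw [ncard_insert_of_notMem hc'.1 hA.finite] at n2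
  rw [ncard_insert_of_notMem hc2.1 (hA.insert_leaf hc').finite,
    ncard_insert_of_notMem hc'.1 hA.finite] at n3
  have k1 : ∀ x ∈ leaves (insert c (insert c' A)) \ children c,
      ∀ y ∈ leaves (insert c (insert c' A)) \ children c,
      ∀ z ∈ leaves (insert c (insert c' A)) \ children c, x ≠ y → x ≠ z → y ≠ z →
      cycle₃ x y z ∈ leafGroup H hP := by
    rw [hl, union_sdiff_right]
    intro x hx y hy z hz
    exact h'.cycle₃_mem_insert hc2 (by omega) hx.1 hy.1 hz.1
  have k2 : ∀ x ∈ leaves (insert c (insert c' A)) \ children c',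
      ∀ y ∈ leaves (insert c (insert c' A)) \ children c',
      ∀ z ∈ leaves (insert c (insert c' A)) \ children c', x ≠ y → x ≠ z → y ≠ z →
      cycle₃ x y z ∈ leafGroup H hP := by
    rw [hl', union_sdiff_right]
    intro x hx y hy z hz hxy hxz hyz
    have := h.cycle₃_mem_insert hc2' (by omega) hx.1 hy.1 hz.1 hxy hxz hyz
    simp only [hcomm] at this
    exact this
  -- The term `2 * d` in the bound leaves two points common to both families of 3-cycles, the centre
  -- of a star.
  have hX : 1 < (leaves (insert c (insert c' A)) \ (children c ∪ children c')).ncard := by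
    have m1 := ncard_union_le (children c) (children c')
    rw [ncard_children (hA.ne_root hc.1), ncard_children (hA.ne_root hc'.1)] at m1
    have m2 := le_ncard_sdiff (children c ∪ children c') (leaves (insert c (insert c' A)))
      ((finite_children c).union (finite_children c'))
    omega
  obtain ⟨a, b, ⟨ha, ha'⟩, ⟨hb, hb'⟩, hab⟩ :=
    (one_lt_ncard_iff (hP.finite_leaves.subset sdiff_subset)).1 hX
  rw [mem_union, not_or] at ha' hb'
  intro x hx y hy z hz
  refine cycle₃_mem_of_star hb hab (fun y hy hya hyb => ?_) hx hy hz
  -- No `y` is a child of both `c` and `c'`, so each `(a b y)` belongs to one of the two families.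
  by_cases hyc : y ∈ children c
  · exact k2 a ⟨ha, ha'.2⟩ b ⟨hb, hb'.2⟩ y ⟨hy, fun h => hcc (hyc.2.symm.trans h.2)⟩ hab hya.symm
      hyb.symm
  · exact k1 a ⟨ha, ha'.1⟩ b ⟨hb, hb'.1⟩ y ⟨hy, hyc⟩ hab hya.symm hyb.symm

/-! ### Full subgroups: induction on the level and density -/

/-- The elements of `H` realize all maps between complete trees with `m` inner vertices, up to even
permutations of the leaves. -/
structure IsFull (H : Subgroup (NeretinGroup d k)) (m : ℕ) : Prop where
  intro ::
  exists_isMap : ∀ A B : Set (TreeVertex d k), IsFiniteRootedSubtree A → IsFiniteRootedSubtree B →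
    A.ncard = m → B.ncard = m → ∃ f : AlmostAut d k, f.IsMap A B ∧ mk f ∈ H
  containsCycles : ∀ (A : Set (TreeVertex d k)) (hA : IsFiniteRootedSubtree A), A.ncard = m →
    ContainsCycles H hA

theorem exists_isFiniteRootedSubtree_ncard (hd : 2 ≤ d) (hk : 2 ≤ k) {n : ℕ} (hn : 1 ≤ n) :
    ∃ A : Set (TreeVertex d k), IsFiniteRootedSubtree A ∧ A.ncard = n := by
  induction n, hn using Nat.le_induction with
  | base => exact ⟨_, IsFiniteRootedSubtree.singleton_root, ncard_singleton _⟩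
  | succ n hn ih =>
    obtain ⟨A, hA, hAn⟩ := ih
    have := hA.ncard_lt_ncard_leaves hd hk
    obtain ⟨c, hc⟩ := nonempty_of_ncard_ne_zero (s := leaves A) (by omega)
    exact ⟨_, hA.insert_leaf hc, by rw [ncard_insert_of_notMem hc.1 hA.finite, hAn]⟩

theorem IsFull.succ {m : ℕ} (h : IsFull H m) (hd : 2 ≤ d) (hk : 2 ≤ k)
    (hm : d.factorial + 2 * d + 6 < m) : IsFull H (m + 1) := by
  have h1 : ∀ A B : Set (TreeVertex d k), IsFiniteRootedSubtree A → IsFiniteRootedSubtree B →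
      A.ncard = m + 1 → B.ncard = m + 1 → ∃ f : AlmostAut d k, f.IsMap A B ∧ mk f ∈ H := by
    intro A B hA hB hAm hBm
    obtain ⟨c, hc, hA'⟩ := hA.exists_sdiff_singleton (by omega)
    obtain ⟨e, he, hB'⟩ := hB.exists_sdiff_singleton (by omega)
    have hAm' := ncard_sdiff_singleton_add_one hc hA.finite
    have hBm' := ncard_sdiff_singleton_add_one he hB.finite
    have hcl := hA.mem_leaves_sdiff_singleton hc hA'
    have hel := hB.mem_leaves_sdiff_singleton he hB'
    obtain ⟨f, hf, hfH⟩ := h.exists_isMap _ _ hA' hB' (by omega) (by omega)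
    have hfc := hf.mapsTo_leaves hcl
    -- Unless `f` already sends `c` to `e`, a 3-cycle with an auxiliary third leaf `w` corrects it.
    -- The composite then restricts to a map from `T ∖ A` to `T ∖ B`.
    have : ∃ g : AlmostAut d k, g.IsMap (B \ {e}) (B \ {e}) ∧ mk g ∈ H ∧
        g.toPartialEquiv (f.toPartialEquiv c) = e := by
      by_cases hfe : f.toPartialEquiv c = e
      · exact ⟨idOn hB', ⟨rfl, rfl⟩, mk_idOn hB' ▸ one_mem _, hfe⟩
      · have hlt : ({f.toPartialEquiv c, e} : Set (TreeVertex d k)).ncard <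
            (leaves (B \ {e})).ncard := by
          have := hB'.ncard_lt_ncard_leaves hd hk
          have := ncard_insert_le (f.toPartialEquiv c) {e}
          have := ncard_singleton e
          omega
        obtain ⟨w, hw, hw'⟩ := exists_mem_notMem_of_ncard_lt_ncard hlt (by simp)
        simp only [mem_insert_iff, mem_singleton_iff, not_or] at hw'
        obtain ⟨-, g, hg, hgH, hgσ⟩ := h.containsCycles _ hB' (by omega) _ hfc _ hel w hw hfe
          (Ne.symm hw'.1) (Ne.symm hw'.2)
        exact ⟨g, hg, hgH, by rw [hgσ _ hfc, cycle₃_apply_left hfe (Ne.symm hw'.1)]⟩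
    obtain ⟨g, hg, hgH, hge⟩ := this
    obtain ⟨f', hf', -, hmk⟩ := (hf.trans hg).exists_restrict_insert hcl
    have hfge : (f.trans g).toPartialEquiv c = e := hge
    rw [hfge, insert_sdiff_self_of_mem hc, insert_sdiff_self_of_mem he] at hf'
    exact ⟨f', hf', hmk ▸ mul_mem hgH hfH⟩
  refine ⟨h1, fun A hA hAm => ?_⟩
  -- One tree `B ∪ {c, c'}` with `m + 1` vertices suffices: by `h1`, elements of `H` transport its
  -- 3-cycles to any `A`.
  obtain ⟨B, hB, hBm⟩ := exists_isFiniteRootedSubtree_ncard (d := d) (k := k) hd hk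
    (n := m - 1) (by omega)
  have hBl := hB.ncard_lt_ncard_leaves hd hk
  obtain ⟨c, c', hc, hc', hcc⟩ := (one_lt_ncard_iff hB.finite_leaves).1 (by omega)
  have hB1 := hB.insert_leaf hc
  have hB2 := hB.insert_leaf hc'
  have e1 := ncard_insert_of_notMem hc.1 hB.finite
  have e2 := ncard_insert_of_notMem hc'.1 hB.finite
  have hc2 : c ∈ leaves (insert c' B) := by
    rw [hB.leaves_insert hc']
    exact Or.inl ⟨hc, hcc⟩
  have hP := hB2.insert_leaf hc2
  have e3 := ncard_insert_of_notMem hc2.1 hB2.finite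
  obtain ⟨f, hf, hfH⟩ := h1 A _ hA hP hAm (by omega)
  exact (ContainsCycles.insert_insert (hA := hB) hc hc' hcc (h.containsCycles _ hB1 (by omega))
    (h.containsCycles _ hB2 (by omega)) hd hk (by omega) hP).of_isMap hf hfH

theorem IsFull.of_le {m n : ℕ} (h : IsFull H m) (hd : 2 ≤ d) (hk : 2 ≤ k)
    (hm : d.factorial + 2 * d + 6 < m) (hmn : m ≤ n) : IsFull H n := by
  induction n, hmn using Nat.le_induction with
  | base => exact h
  | succ n hmn ih => exact ih.succ hd hk (by omega)

theorem _root_.IsFiniteRootedSubtree.exists_superset_ncard_ge (hA : IsFiniteRootedSubtree A)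
    (hd : 2 ≤ d) (hk : 2 ≤ k) (m : ℕ) :
    ∃ A' : Set (TreeVertex d k), IsFiniteRootedSubtree A' ∧ A ⊆ A' ∧ m ≤ A'.ncard := by
  obtain ⟨B, hB, hBm⟩ := exists_isFiniteRootedSubtree_ncard (d := d) (k := k) hd hk
    (n := m + 1) (by omega)
  refine ⟨A ∪ B, hA.union hB, subset_union_left, ?_⟩
  have := ncard_le_ncard (subset_union_right (s := A) (t := B)) (hA.union hB).finite
  omega

/-- A closed subgroup that is full is the whole group. -/
theorem IsFull.mem {m : ℕ} (h : IsFull H m) (hd : 2 ≤ d) (hk : 2 ≤ k)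
    (hm : d.factorial + 2 * d + 6 < m) (hH : IsClosed (H : Set (NeretinGroup d k)))
    (g : NeretinGroup d k) : g ∈ H := by
  change g ∈ (H : Set (NeretinGroup d k))
  rw [← hH.closure_eq, mem_closure_iff_nhds]
  intro U hU
  obtain ⟨F, hF, hFU⟩ := mem_nhds_iff'.1 hU
  obtain ⟨f₀, rfl⟩ := Quotient.exists_rep g
  obtain ⟨A₁, hA₁, hFA₁⟩ := IsFiniteRootedSubtree.exists_superset hF
  obtain ⟨A, hA, hAA, hAm⟩ :=
    (hA₁.union f₀.source_subtree).exists_superset_ncard_ge hd hk m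
  have hf₀ : f₀.IsMap f₀.toPartialEquiv.sourceᶜ f₀.toPartialEquiv.targetᶜ :=
    ⟨(compl_compl _).symm, (compl_compl _).symm⟩
  have := hA.ncard_lt_ncard_leaves hd hk
  -- Adding the leaf `e` makes its children sibling leaves of the enlarged tree; they serve to
  -- correct the parity.
  obtain ⟨e, he⟩ := nonempty_of_ncard_ne_zero (s := leaves A) (by omega)
  have hA' := hA.insert_leaf he
  obtain ⟨B, f, hf, -, -, hmk⟩ := hf₀.exists_restrict hA'
    ((subset_union_right.trans hAA).trans (subset_insert _ _))
  obtain ⟨h₀, hh₀, hh₀H⟩ := (h.of_le hd hk hm (n := (insert e A).ncard) (by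
    have := ncard_insert_of_notMem he.1 hA.finite
    omega)).exists_isMap _ _ hA' hf.right rfl (hf.ncard_eq hd).symm
  -- If `l ∈ H` induces `ρ`, then `f⁻¹ l h₀` preserves the parents of leaves, so it is an
  -- automorphism `a` fixing `F`. Then `g a = l h₀` lies in `H`.
  suffices hΓ : ∃ ρ ∈ leafGroup H hf.right, ∀ v ∈ leaves (insert e A),
      parent (f.symm.toPartialEquiv (ρ (h₀.toPartialEquiv v))) = parent v by
    obtain ⟨ρ, ⟨-, l, hl, hlH, hlρ⟩, hρ⟩ := hΓ
    obtain ⟨a, ha, haw⟩ := ((hh₀.trans hl).trans hf.symm).exists_eq_ofAut fun v hv => by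
      rw [← hρ v hv, ← hlρ _ (hh₀.mapsTo_leaves hv)]
      rfl
    refine ⟨_, hFU a fun v hv => ha v (Or.inr (hAA (Or.inl (hFA₁ hv)))), ?_⟩
    change mk f₀ * _ ∈ H
    rw [haw, mk_trans, mk_symm, hmk, mul_inv_cancel_left]
    exact mul_mem hlH hh₀H
  obtain ⟨e₀, e₁, he₀, he₁, hee⟩ := (one_lt_ncard_iff (finite_children e)).1
    (by rw [ncard_children (hA.ne_root he.1)]; omega)
  have hch : children e ⊆ leaves (insert e A) := by
    rw [hA.leaves_insert he]
    exact subset_union_right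
  obtain ⟨σ, hσ, hσf⟩ := (hh₀.symm.trans hf).exists_perm
  have hσ' : ∀ v ∈ leaves (insert e A), σ (h₀.toPartialEquiv v) = f.toPartialEquiv v := by
    intro v hv
    rw [hσf _ (hh₀.mapsTo_leaves hv)]
    exact congrArg f.toPartialEquiv (hh₀.left_inv hv.1)
  have hfull := (h.of_le hd hk hm (n := B.ncard) (by
    have := ncard_insert_of_notMem he.1 hA.finite
    have := hf.ncard_eq hd
    omega)).containsCycles _ hf.right rfl
  -- Here `σ` is the permutation with `σ h₀ = f` on leaves. If only its product with the swap of `f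
  -- e₀` and `f e₁` is available, `f⁻¹ ρ h₀` swaps the siblings `e₀`, `e₁`, and parents are still
  -- preserved.
  rcases mem_or_swap_mul_mem hfull (hf.mapsTo_leaves (hch he₀)) (hf.mapsTo_leaves (hch he₁))
    (hf.bijOn_leaves.injOn.ne (hch he₀) (hch he₁) hee) hf.right.finite_leaves σ hσ with hΓ | hΓ
  · refine ⟨_, hΓ, fun v hv => ?_⟩
    rw [hσ' v hv]
    exact congrArg parent (hf.left_inv hv.1)
  · refine ⟨_, hΓ, fun v hv => ?_⟩
    rw [Equiv.Perm.mul_apply, hσ' v hv]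
    by_cases hv0 : v = e₀
    · rw [hv0, Equiv.swap_apply_left, he₀.2, ← he₁.2]
      exact congrArg parent (hf.left_inv (hch he₁).1)
    by_cases hv1 : v = e₁
    · rw [hv1, Equiv.swap_apply_right, he₁.2, ← he₀.2]
      exact congrArg parent (hf.left_inv (hch he₀).1)
    have hinj := hf.bijOn_leaves.injOn
    rw [Equiv.swap_apply_of_ne_of_ne (hinj.ne hv (hch he₀) hv0) (hinj.ne hv (hch he₁) hv1)]
    exact congrArg parent (hf.left_inv hv.1)

/-- Trees with `m` vertices have equally many leaves, and every bijection of leaves extends to a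
forest isomorphism. -/
theorem isFull_top (m : ℕ) : IsFull (⊤ : Subgroup (NeretinGroup d k)) m := by
  constructor
  · intro A B hA hB hAm hBm
    have h1 := hA.ncard_leaves
    have h2 := hB.ncard_leaves
    obtain ⟨s, hs⟩ := hA.finite_leaves.exists_bijOn_of_encard_eq (t := leaves B) (by
      rw [← hA.finite_leaves.cast_ncard_eq, ← hB.finite_leaves.cast_ncard_eq]
      rw [hAm] at h1
      rw [hBm] at h2
      congr 1
      omega)
    obtain ⟨f, hf, -⟩ := exists_isMap_extending hA hB hs
    exact ⟨f, hf, trivial⟩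
  · intro A hA _ x hx y hy z hz _ _ _
    have hfix : ∀ v ∉ leaves A, cycle₃ x y z v = v := fun v hv => cycle₃_apply_of_ne
      (fun e => hv (e ▸ hx)) (fun e => hv (e ▸ hy)) fun e => hv (e ▸ hz)
    have hmaps : MapsTo (cycle₃ x y z) (leaves A) (leaves A) := by
      intro v hv
      by_contra hc
      rw [(cycle₃ x y z).injective (hfix _ hc)] at hc
      exact hc hv
    obtain ⟨f, hf, hfv⟩ := exists_isMap_extending hA hA
      (BijOn.mk hmaps (cycle₃ x y z).injective.injOn
        fun v hv => by
          obtain ⟨u, rfl⟩ := (cycle₃ x y z).surjective v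
          exact ⟨u, by_contra fun hc => hc (hfix u hc ▸ hv), rfl⟩)
    exact ⟨hfix, f, hf, trivial, hfv⟩

/-! ### Fullness is an open condition -/

/-- The group elements with prescribed source, target and action on leaves form an open set, since
precomposing with an automorphism that fixes `A` and its leaves changes none of these data. So this
is a subbasic Chabauty set of the form `{H | H ∩ W ≠ ∅}`. -/
theorem isOpen_setOf_exists_isMap (A B : Set (TreeVertex d k))
    (s : TreeVertex d k → TreeVertex d k) :
    IsOpen {H : ClosedSubgroup (NeretinGroup d k) | ∃ f : AlmostAut d k, f.IsMap A B ∧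
      mk f ∈ H.toSubgroup ∧ ∀ v ∈ leaves A, f.toPartialEquiv v = s v} := by
  let W : Set (NeretinGroup d k) :=
    {g | ∃ f : AlmostAut d k, f.IsMap A B ∧ mk f = g ∧ ∀ v ∈ leaves A, f.toPartialEquiv v = s v}
  have hW : IsOpen W := by
    rintro _ ⟨f, hf, rfl, hfs⟩
    refine ⟨A ∪ leaves A, hf.left.finite.union hf.left.finite_leaves, fun a ha =>
      ⟨(AlmostAut.ofAut a).trans f, hf.ofAut_trans a fun v hv => ha v (Or.inl hv), rfl,
        fun v hv => ?_⟩⟩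
    rw [← hfs v hv]
    exact congrArg f.toPartialEquiv (ha v (Or.inr hv))
  refine TopologicalSpace.isOpen_generateFrom_of_mem (Or.inr ⟨W, hW, ?_⟩)
  ext H
  constructor
  · rintro ⟨f, hf, hfH, hfs⟩
    exact ⟨_, hfH, f, hf, rfl, hfs⟩
  · rintro ⟨_, hfH, f, hf, rfl, hfs⟩
    exact ⟨f, hf, hfH, hfs⟩

/-- Fullness is a finite conjunction of conditions that are open by `isOpen_setOf_exists_isMap`; the
mere existence of a map from `A` to `B` is a union over its possible actions `s` on leaves. -/
theorem isOpen_setOf_isFull (d k m : ℕ) :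
    IsOpen {H : ClosedSubgroup (NeretinGroup d k) | IsFull H.toSubgroup m} := by
  have hfin := finite_setOf_isFiniteRootedSubtree_ncard_eq d k m
  have h1 := hfin.isOpen_biInter fun A _ => hfin.isOpen_biInter fun B _ =>
    isOpen_iUnion fun s => isOpen_setOf_exists_isMap A B s
  have h2 := hfin.isOpen_biInter fun A hA => hA.1.finite_leaves.isOpen_biInter fun x _ =>
    hA.1.finite_leaves.isOpen_biInter fun y _ => hA.1.finite_leaves.isOpen_biInter fun z _ =>
    isOpen_iInter_of_finite fun _ : x ≠ y => isOpen_iInter_of_finite fun _ : x ≠ z =>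
    isOpen_iInter_of_finite fun _ : y ≠ z => isOpen_setOf_exists_isMap A A (cycle₃ x y z)
  convert h1.inter h2
  ext H
  simp only [mem_inter_iff, mem_iInter, mem_iUnion, mem_ofPred_eq]
  constructor
  · rintro ⟨h1, h2⟩
    refine ⟨fun A hA B hB => ?_, fun A hA x hx y hy z hz hxy hxz hyz =>
      (h2 A hA.1 hA.2 x hx y hy z hz hxy hxz hyz).2⟩
    obtain ⟨f, hf, hfH⟩ := h1 A B hA.1 hB.1 hA.2 hB.2
    exact ⟨_, f, hf, hfH, fun _ _ => rfl⟩
  · rintro ⟨h1, h2⟩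
    refine ⟨fun A B hA hB hAm hBm => ?_, fun A hA hAm x hx y hy z hz hxy hxz hyz =>
      ⟨fun v hv => cycle₃_apply_of_ne (fun e => hv (e ▸ hx)) (fun e => hv (e ▸ hy))
        fun e => hv (e ▸ hz), h2 A ⟨hA, hAm⟩ x hx y hy z hz hxy hxz hyz⟩⟩
    obtain ⟨_, f, hf, hfH, -⟩ := h1 A ⟨hA, hAm⟩ B ⟨hB, hBm⟩
    exact ⟨f, hf, hfH⟩

end NeretinGroup

theorem mainTheorem6 (d k : ℕ) (hd : 2 ≤ d) (hk : 2 ≤ k) :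
    IsOpen ({ClosedSubgroup.whole (NeretinGroup d k)} :
      Set (ClosedSubgroup (NeretinGroup d k))) := by
  -- The least level above the threshold in `IsFull.mem`; there the full closed subgroups reduce to
  -- the whole group.
  convert NeretinGroup.isOpen_setOf_isFull d k (d.factorial + 2 * d + 7)
  ext H
  rw [mem_singleton_iff]
  constructor
  · rintro rfl
    exact NeretinGroup.isFull_top _
  · intro h
    refine SetLike.ext fun g => ⟨fun _ => trivial, fun _ => ?_⟩
    exact h.mem hd hk (by omega) H.isClosed' g
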